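/- Let $G$ be a compact connected Lie group with Lie algebra $\mathfrak g$, equipped with an $\mathrm{Ad}_G$-invariant inner product, used to identify $\mathfrak g\simeq\mathfrak g^*$, and let $V_1,\dots,V_d$ be an orthonormal basis of $\mathfrak g$. Let $(M,\omega)$ and $(N,\omega^N)$ be symplectic manifolds, $N$ compact, with almost complex structures $J^M,J^N$ such that $g^{TM}=\omega(\cdot,J^M\cdot)$ and $g^{TN}=\omega^N(\cdot,J^N\cdot)$ are Riemannian metrics. Let $G$ act smoothly on $M$ and $N$, preserving these structures, with moment maps $\mu:M\to\mathfrak g^*$, $\eta:N\to\mathfrak g^*$, i.e. $d\mu(K)=i_{K^M}\omega$ and $d\eta(K)=i_{K^N}\omega^N$ for all $K\in\mathfrak g$, where $K^M_x=\frac{d}{dt}\big|_{t=0}e^{-tK}x$ and similarly for $K^N$; assume that $\mu$ is proper. Put $\theta(x,y)=\mu(x)+\eta(y)$ on $M\times N$. A subscript $j$ denotes the $j$-th component in the basis $(V_j)$, and repeated indices are summed. Let $\widetilde\alpha,\widetilde\phi\in C^\infty(\mathbb R)$ satisfy $\widetilde\alpha(t)=t^2$, $\widetilde\phi(t)=1-t^3$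 for $t\le\frac13$; $\widetilde\alpha(t)=1$, $\widetilde\phi(t)=2(1-t)$ for $t\ge\frac23$; and $\widetilde\alpha(t)+\widetilde\phi(t)\ge\frac{29}{27}$, $\widetilde\phi'(t)<0$ for $\frac13\le t\le\frac23$. For $A>0$ set $\alpha(t)=\widetilde\alpha(\frac tA-1)$, $\phi(t)=\widetilde\phi(\frac tA-1)$ and, on $M\times N$, $$\beta=|\mu|^2+\alpha(|\mu|^2)(|\theta|^2-|\mu|^2),\qquad \rho=\theta-\phi(\beta)\eta,$$ $$\gamma_j=2\bigl(1+\alpha'(|\mu|^2)(|\theta|^2-|\mu|^2)\bigr)\mu_j+2\alpha(|\mu|^2)\eta_j,\qquad \psi_j=2\rho_j-2\phi'(\beta)\rho_i\eta_i\gamma_j,$$ $$X^\rho=\psi_j\,(V_j^M+V_j^N),\qquad \mathcal M=\{(x,y)\in M\times N:\ |\mu(x)|^2\ge A,\ |\theta(x,y)|^2\le 2A\}.$$ Let $\Lambda(T^{*(0,1)}(M\times N))$ carry its induced Hermitian metric. A tangent vector $W=w+\bar w$ with $w\in T^{(1,0)}$, $\bar w\in T^{(0,1)}$ acts on it by $c(W)=\sqrt2(\bar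 w^*\wedge-\,i_{\bar w})$, where $\bar w^*\in T^{*(0,1)}$ is the metric dual of $w$. Write $(d^M\psi_j)^*$, $(d^N\psi_j)^*$ for the metric duals of the differentials of $\psi_j$ along $M$ and $N$, and let $$I_1=\tfrac14 c\bigl((d^M\psi_j)^*\bigr)c\bigl(V_j^M+2V_j^N\bigr)+\tfrac12 c\bigl((d^N\psi_j)^*\bigr)c\bigl(V_j^M\bigr),\qquad I_2=\tfrac14\Bigl\langle\Bigl(1+\tfrac{J^M}{\sqrt{-1}}\Bigr)V_j^M,(d^M\psi_j)^*\Bigr\rangle,$$ where $\langle\cdot,\cdot\rangle$ is extended $\mathbb C$-bilinearly. Then there exist $C>0$ and $A_0>0$ such that for every $A>A_0$ and every $(x,y)\in\mathcal M$ with $X^\rho(x,y)=0$, the endomorphism $\sqrt{-1}(I_1+I_2)$ of $\Lambda(T^{*(0,1)}(M\times N))_{(x,y)}$ is self-adjoint and $$\sqrt{-1}(I_1+I_2)\ \ge\ -C\,\mathrm{Id}.$$ -/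

import Mathlib

open scoped Manifold ContDiff ComplexConjugate

noncomputable section

namespace MomentMapDeformation

/-! ### Pointwise linear algebra: Clifford action on the exterior algebra of `(0,1)`-covectors -/

/-- A complex structure `J` on a real vector space together with a compatible inner product `g`. -/
structure HermitianStructure (V : Type*) [AddCommGroup V] [Module ℝ V] where
  J : V →ₗ[ℝ] V
  g : LinearMap.BilinForm ℝ V
  J_sq : ∀ v, J (J v) = -v
  symm : ∀ u v, g u v = g v u
  pos : ∀ v, v ≠ 0 → 0 < g v v
  g_J : ∀ u v, g (J u) (J v) = g u v

namespace HermitianStructure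

variable {V W : Type*} [AddCommGroup V] [Module ℝ V] [AddCommGroup W] [Module ℝ W]

/-- The orthogonal direct sum of two Hermitian structures. -/
def prod (S : HermitianStructure V) (S' : HermitianStructure W) :
    HermitianStructure (V × W) where
  J := S.J.prodMap S'.J
  g := S.g.compl₁₂ (LinearMap.fst ℝ V W) (LinearMap.fst ℝ V W) +
    S'.g.compl₁₂ (LinearMap.snd ℝ V W) (LinearMap.snd ℝ V W)
  J_sq v := by ext <;> simp [S.J_sq, S'.J_sq]
  symm u v := by
    simp only [LinearMap.add_apply, LinearMap.compl₁₂_apply, LinearMap.fst_apply,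
      LinearMap.snd_apply]
    rw [S.symm u.1 v.1, S'.symm u.2 v.2]
  pos := by
    rintro ⟨v, w⟩ h
    simp only [LinearMap.add_apply, LinearMap.compl₁₂_apply, LinearMap.fst_apply,
      LinearMap.snd_apply]
    by_cases hv : v = 0
    · have hw : w ≠ 0 := by rintro rfl; exact h (by simp [hv])
      simpa [hv] using S'.pos w hw
    · by_cases hw : w = 0
      · simpa [hw] using S.pos v hv
      · exact add_pos (S.pos v hv) (S'.pos w hw)
  g_J u v := by simp [S.g_J, S'.g_J]

variable (S : HermitianStructure V)

theorem nondegenerate : S.g.Nondegenerate := by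
  have hs : ∀ m, S.g m m = 0 → m = 0 := fun m h => by
    by_contra hm
    exact (S.pos m hm).ne' h
  exact ⟨fun m h => hs m (h m), fun m h => hs m (h m)⟩

/-- The metric dual `f^*` of a covector: `g (f^*) v = f v`. -/
def sharp [FiniteDimensional ℝ V] (f : Module.Dual ℝ V) : V :=
  (LinearMap.BilinForm.toDual S.g S.nondegenerate).symm f

theorem g_sharp [FiniteDimensional ℝ V] (f : Module.Dual ℝ V) (v : V) :
    S.g (S.sharp f) v = f v :=
  LinearMap.BilinForm.apply_toDual_symm_apply _ _

/-- `T^{*(0,1)}`, the dual of the `(-√-1)`-eigenspace `T^{(0,1)}` of `J` in the complexification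
`V_ℂ = T^{(1,0)} ⊕ T^{(0,1)}`. A functional on `T^{(0,1)}`, extended by `0` on `T^{(1,0)}`, is the
same as an `ℝ`-linear `f : V → ℂ` with `f (J v) = -√-1 f v`. -/
def Covector01 : Submodule ℂ (V →ₗ[ℝ] ℂ) where
  carrier := {f | ∀ v, f (S.J v) = -Complex.I * f v}
  add_mem' := by
    intro a b ha hb v
    simp only [Set.mem_ofPred_eq] at ha hb
    simp only [LinearMap.add_apply, ha v, hb v]
    ring
  zero_mem' := by intro v; simp
  smul_mem' := by
    intro c f hf v
    simp only [Set.mem_ofPred_eq] at hf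
    simp only [LinearMap.smul_apply, hf v, smul_eq_mul]
    ring

/-- For `v ∈ V`, written `v = w + w̄` with `w = (v - √-1 J v) / 2 ∈ T^{(1,0)}`, the metric dual
`w̄^* = g_ℂ(w, ·) ∈ T^{*(0,1)}` of `w`, where `g_ℂ` is the `ℂ`-bilinear extension of `g`. -/
def dual01 (v : V) : S.Covector01 where
  val :=
    { toFun := fun u => ((S.g v u : ℝ) - Complex.I * (S.g (S.J v) u : ℝ)) / 2
      map_add' := by
        intro a b
        simp only [map_add, Complex.ofReal_add]
        ring
      map_smul' := by
        intro c a
        simp only [map_smul, smul_eq_mul, Complex.ofReal_mul, RingHom.id_apply, Complex.real_smul]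
        ring }
  property := by
    intro u
    have h1 : S.g v (S.J u) = -S.g (S.J v) u := by
      have h := S.g_J v (S.J u)
      rw [S.J_sq, map_neg] at h
      exact h.symm
    simp only [LinearMap.coe_mk, AddHom.coe_mk, S.g_J, h1]
    push_cast
    linear_combination -(((S.g (S.J v) u : ℝ) : ℂ) / 2) * Complex.I_sq

/-- Evaluation of elements of `T^{*(0,1)}` at the component `w̄ ∈ T^{(0,1)}` of `v = w + w̄`
(as these functionals vanish at `w`, this is evaluation at `v`). -/
def eval01 (v : V) : Module.Dual ℂ S.Covector01 where
  toFun f := f.1 v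
  map_add' _ _ := rfl
  map_smul' _ _ := rfl

/-- `Λ(T^{*(0,1)})`. -/
abbrev Spinor : Type _ := ExteriorAlgebra ℂ S.Covector01

/-- The Clifford action `c(v) = √2 (w̄^* ∧ - i_{w̄})` of `v = w + w̄` on `Λ(T^{*(0,1)})`. -/
def cliff (v : V) : Module.End ℂ S.Spinor :=
  ((Real.sqrt 2 : ℝ) : ℂ) •
    (LinearMap.mulLeft ℂ (ExteriorAlgebra.ι ℂ (S.dual01 v)) -
      CliffordAlgebra.contractLeft (Q := (0 : QuadraticForm ℂ S.Covector01)) (S.eval01 v))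

variable [FiniteDimensional ℝ V]

theorem eq_dual01 (f : S.Covector01) :
    f = S.dual01 ((2 : ℝ) • S.sharp (Complex.reLm ∘ₗ f.1)) := by
  have hf : ∀ v, f.1 (S.J v) = -Complex.I * f.1 v := f.2
  have hJ : ∀ a b, S.g (S.J a) b = -S.g a (S.J b) := fun a b => by
    have h := S.g_J a (S.J b)
    rw [S.J_sq, map_neg] at h
    linarith
  apply Subtype.ext
  ext v
  simp only [dual01, LinearMap.coe_mk, AddHom.coe_mk, map_smul, LinearMap.smul_apply, hJ,
    g_sharp, LinearMap.comp_apply, Complex.reLm_coe, smul_eq_mul, hf]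
  apply Complex.ext <;> simp

/-- The Hermitian metric on `T^{*(0,1)}` induced by `g`, antilinear in the first variable:
`⟨w̄^*, u̅^*⟩ = g_ℂ(u, w̄)`, so that `|w̄^*|² = g_ℂ(w, w̄) = |v|² / 2` for `v = w + w̄`. -/
def covInner (f f' : S.Covector01) : ℂ :=
  f'.1 ((2 : ℝ) • S.sharp (Complex.reLm ∘ₗ f.1))

theorem covInner_dual01 (v v' : V) :
    S.covInner (S.dual01 v) (S.dual01 v') =
      ((S.g v' v : ℝ) - Complex.I * (S.g (S.J v') v : ℝ)) / 2 := by
  have h : (2 : ℝ) • S.sharp (Complex.reLm ∘ₗ (S.dual01 v).1) = v := by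
    apply (LinearMap.BilinForm.toDual S.g S.nondegenerate).injective
    ext u
    rw [LinearMap.BilinForm.toDual_def, LinearMap.BilinForm.toDual_def, map_smul,
      LinearMap.smul_apply, g_sharp]
    simp only [dual01, LinearMap.comp_apply, LinearMap.coe_mk, AddHom.coe_mk,
      Complex.reLm_coe, smul_eq_mul]
    simp
    ring
  rw [covInner, h]
  rfl

theorem exists_orthonormal_basis :
    ∃ b : Module.Basis (Fin (Module.finrank ℂ S.Covector01)) ℂ S.Covector01,
      ∀ i j, S.covInner (b i) (b j) = if i = j then 1 else 0 := by
  have hJ : ∀ a b, S.g (S.J a) b = -S.g (S.J b) a := fun a b => by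
    have h := S.g_J a (S.J b)
    rw [S.J_sq, map_neg, S.symm a] at h
    linarith
  let core : InnerProductSpace.Core ℂ S.Covector01 :=
    { inner := S.covInner
      conj_inner_symm := by
        intro x y
        rw [S.eq_dual01 x, S.eq_dual01 y, covInner_dual01, covInner_dual01]
        simp only [map_div₀, map_sub, map_mul, Complex.conj_ofReal, Complex.conj_I, map_ofNat]
        rw [S.symm, hJ]
        push_cast
        ring
      re_inner_nonneg := by
        intro x
        rw [S.eq_dual01 x, covInner_dual01]
        set v := (2 : ℝ) • S.sharp (Complex.reLm ∘ₗ x.1)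
        have h0 : S.g (S.J v) v = 0 := by have := hJ v v; linarith
        rw [h0]
        by_cases hv : v = 0
        · simp [hv]
        · have := S.pos v hv
          simp
          linarith
      add_left := by
        intro x y z
        have h : S.covInner (x + y) z = S.covInner x z + S.covInner y z := by
          simp only [covInner, sharp, Submodule.coe_add, LinearMap.comp_add, map_add, smul_add]
        exact h
      smul_left := by
        intro x y c
        have h1 : S.sharp (Complex.reLm ∘ₗ (c • x : S.Covector01).1) =
            c.re • S.sharp (Complex.reLm ∘ₗ x.1) + c.im • S.J (S.sharp (Complex.reLm ∘ₗ x.1)) := by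
          apply (LinearMap.BilinForm.toDual S.g S.nondegenerate).injective
          ext u
          have hx : x.1 (S.J u) = -Complex.I * x.1 u := x.2 u
          have h2 : S.g (S.J (S.sharp (Complex.reLm ∘ₗ x.1))) u = - (x.1 u).im := by
            rw [hJ, S.symm, g_sharp]
            simp [hx]
          simp only [LinearMap.BilinForm.toDual_def, map_add, map_smul, LinearMap.add_apply,
            LinearMap.smul_apply, g_sharp, h2]
          simp
          ring
        have hy : ∀ u, y.1 (S.J u) = -Complex.I * y.1 u := y.2
        change S.covInner (c • x) y = conj c * S.covInner x y
        simp only [covInner, h1, map_smul, map_add, hy, Complex.real_smul]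
        apply Complex.ext <;> simp <;> ring
      definite := by
        intro x h
        change S.covInner x x = 0 at h
        rw [S.eq_dual01 x] at h ⊢
        set v := (2 : ℝ) • S.sharp (Complex.reLm ∘ₗ x.1)
        have hv : v = 0 := by
          by_contra hv
          have h0 : S.g (S.J v) v = 0 := by have := hJ v v; linarith
          rw [covInner_dual01, h0] at h
          have h3 := S.pos v hv
          have h4 := congrArg Complex.re h
          simp at h4
          linarith
        rw [hv]
        apply Subtype.ext
        ext u
        simp [dual01] }
  let _ : NormedAddCommGroup S.Covector01 := core.toNormedAddCommGroup
  let _ : InnerProductSpace ℂ S.Covector01 := InnerProductSpace.ofCore core.toCore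
  let b := stdOrthonormalBasis ℂ S.Covector01
  refine ⟨b.toBasis, fun i j => ?_⟩
  have h := (orthonormal_iff_ite.1 b.orthonormal) i j
  rw [OrthonormalBasis.coe_toBasis]
  exact h

/-- An orthonormal basis of `T^{*(0,1)}`. -/
def covBasis : Module.Basis (Fin (Module.finrank ℂ S.Covector01)) ℂ S.Covector01 :=
  S.exists_orthonormal_basis.choose

/-- The Hermitian metric on `Λ(T^{*(0,1)})` induced by the one on `T^{*(0,1)}`: the products
`e_{i₁} ∧ ⋯ ∧ e_{iₖ}`, `i₁ < ⋯ < iₖ`, of an orthonormal basis `e` form an orthonormal basis.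
Antilinear in the first variable. -/
def spinorInner (σ τ : S.Spinor) : ℂ :=
  ∑ s : Finset (Fin (Module.finrank ℂ S.Covector01)),
    conj (S.covBasis.ExteriorAlgebra.repr σ s) * S.covBasis.ExteriorAlgebra.repr τ s

/-- `T ≥ c • Id` for an endomorphism of `Λ(T^{*(0,1)})`: `T` is self-adjoint and
`⟨σ, T σ⟩ ≥ c |σ|²` for all `σ`. -/
def GeSmulId (T : Module.End ℂ S.Spinor) (c : ℝ) : Prop :=
  (∀ σ τ, S.spinorInner (T σ) τ = S.spinorInner σ (T τ)) ∧
    ∀ σ, c * (S.spinorInner σ σ).re ≤ (S.spinorInner σ (T σ)).re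

end HermitianStructure

/-! ### Symplectic manifolds with a compatible almost complex structure -/

section Manifold

variable (E : Type*) [NormedAddCommGroup E] [NormedSpace ℝ E]
  (M : Type*) [TopologicalSpace M] [ChartedSpace E M]

/-- The coordinate expression of a `2`-form in the chart at `x₀`. -/
def coordForm
    (w : ∀ x : M, TangentSpace 𝓘(ℝ, E) x →L[ℝ] TangentSpace 𝓘(ℝ, E) x →L[ℝ] ℝ) (x₀ : M)
    (u : E) : E →L[ℝ] E →L[ℝ] ℝ :=
  let D : E →L[ℝ] E := mfderiv 𝓘(ℝ, E) 𝓘(ℝ, E) (chartAt E x₀).symm u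
  let w' : E →L[ℝ] E →L[ℝ] ℝ := w ((chartAt E x₀).symm u)
  w'.bilinearComp D D

/-- A symplectic form and an almost complex structure `J`, both smooth, such that
`g(u, v) = symp(u, J v)` is a Riemannian metric. -/
structure AlmostKahler [IsManifold 𝓘(ℝ, E) ∞ M] where
  symp : ∀ x : M, TangentSpace 𝓘(ℝ, E) x →L[ℝ] TangentSpace 𝓘(ℝ, E) x →L[ℝ] ℝ
  J : ∀ x : M, TangentSpace 𝓘(ℝ, E) x →L[ℝ] TangentSpace 𝓘(ℝ, E) x
  smooth_symp : ContMDiff 𝓘(ℝ, E) (𝓘(ℝ, E).prod 𝓘(ℝ, E →L[ℝ] E →L[ℝ] ℝ)) ∞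
    (fun x => Bundle.TotalSpace.mk' (E →L[ℝ] E →L[ℝ] ℝ)
      (E := fun x : M => TangentSpace 𝓘(ℝ, E) x →L[ℝ] TangentSpace 𝓘(ℝ, E) x →L[ℝ] ℝ) x (symp x))
  smooth_J : ContMDiff 𝓘(ℝ, E) (𝓘(ℝ, E).prod 𝓘(ℝ, E →L[ℝ] E)) ∞
    (fun x => Bundle.TotalSpace.mk' (E →L[ℝ] E)
      (E := fun x : M => TangentSpace 𝓘(ℝ, E) x →L[ℝ] TangentSpace 𝓘(ℝ, E) x) x (J x))
  symp_self : ∀ x v, symp x v v = 0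
  /-- The exterior derivative of the form vanishes, in charts. -/
  closed : ∀ x₀ : M, ∀ u ∈ (chartAt E x₀).target, ∀ a b c : E,
    fderiv ℝ (coordForm E M symp x₀) u a b c + fderiv ℝ (coordForm E M symp x₀) u b c a +
      fderiv ℝ (coordForm E M symp x₀) u c a b = 0
  J_sq : ∀ x v, J x (J x v) = -v
  g_symm : ∀ x u v, symp x u (J x v) = symp x v (J x u)
  g_pos : ∀ x v, v ≠ 0 → 0 < symp x v (J x v)

variable {E M} [IsManifold 𝓘(ℝ, E) ∞ M]

instance [FiniteDimensional ℝ E] (x : M) : FiniteDimensional ℝ (TangentSpace 𝓘(ℝ, E) x) :=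
  inferInstanceAs (FiniteDimensional ℝ E)

/-- The metric `g(u, v) = symp(u, J v)` and `J` on the tangent space at `x`. -/
def AlmostKahler.tangent (S : AlmostKahler E M) (x : M) :
    HermitianStructure (TangentSpace 𝓘(ℝ, E) x) where
  J := (S.J x).toLinearMap
  g := LinearMap.mk₂ ℝ (fun u v => S.symp x u (S.J x v))
    (by intros; simp) (by intros; simp) (by intros; simp) (by intros; simp)
  J_sq v := S.J_sq x v
  symm u v := S.g_symm x u v
  pos v hv := S.g_pos x v hv
  g_J u v := by
    have h1 : ∀ a b, S.symp x a b = -S.symp x b a := fun a b => by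
      have h := S.symp_self x (a + b)
      simp only [map_add, add_apply, S.symp_self] at h
      linarith
    simp only [LinearMap.mk₂_apply, ContinuousLinearMap.coe_coe, S.J_sq, map_neg]
    rw [h1 (S.J x u) v, neg_neg, S.g_symm]

/-! ### Lie group actions and moment maps -/

variable {EG : Type*} [NormedAddCommGroup EG] [NormedSpace ℝ EG]
  {G : Type*} [TopologicalSpace G] [ChartedSpace EG G] [Group G]

/-- `Ad g`, the derivative at `1` of the conjugation `h ↦ g h g⁻¹`. -/
def Ad (g : G) (K : GroupLieAlgebra 𝓘(ℝ, EG) G) : GroupLieAlgebra 𝓘(ℝ, EG) G :=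
  (mfderiv 𝓘(ℝ, EG) 𝓘(ℝ, EG) (fun h : G => g * h * g⁻¹) 1 : EG →L[ℝ] EG) K

/-- An `Ad`-invariant inner product on the Lie algebra of `G`. -/
structure IsAdInvariantInner (ip : LinearMap.BilinForm ℝ (GroupLieAlgebra 𝓘(ℝ, EG) G)) :
    Prop where
  symm : ∀ K L, ip K L = ip L K
  pos : ∀ K, K ≠ 0 → 0 < ip K K
  ad : ∀ (g : G) K L, ip (Ad g K) (Ad g L) = ip K L

variable [MulAction G M]

/-- The vector field `K^M` generated by `K`: at `x`, the derivative at `t = 0` of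
`exp (-t K) • x`, i.e. the derivative at `1` of `g ↦ g • x` in the direction `-K`. -/
def genField (K : GroupLieAlgebra 𝓘(ℝ, EG) G) (x : M) : TangentSpace 𝓘(ℝ, E) x :=
  (mfderiv 𝓘(ℝ, EG) 𝓘(ℝ, E) (fun g : G => g • x) 1 : EG →L[ℝ] E) (-K)

/-- `G` acts smoothly, preserving the symplectic form and the almost complex structure, and
`μ : M → 𝔤^*` is a moment map: `d(μ(K)) = symp(K^M, ·)` for all `K` in the Lie algebra `𝔤`. -/
structure IsHamiltonianAction (S : AlmostKahler E M)
    (μ : M → (GroupLieAlgebra 𝓘(ℝ, EG) G →L[ℝ] ℝ)) : Prop where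
  smooth_action : ContMDiff (𝓘(ℝ, EG).prod 𝓘(ℝ, E)) 𝓘(ℝ, E) ∞ (fun p : G × M => p.1 • p.2)
  symp_invariant : ∀ (g : G) (x : M) (u v : TangentSpace 𝓘(ℝ, E) x),
    S.symp (g • x) (mfderiv 𝓘(ℝ, E) 𝓘(ℝ, E) (fun z : M => g • z) x u)
      (mfderiv 𝓘(ℝ, E) 𝓘(ℝ, E) (fun z : M => g • z) x v) = S.symp x u v
  J_invariant : ∀ (g : G) (x : M) (u : TangentSpace 𝓘(ℝ, E) x),
    S.J (g • x) (mfderiv 𝓘(ℝ, E) 𝓘(ℝ, E) (fun z : M => g • z) x u) =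
      mfderiv 𝓘(ℝ, E) 𝓘(ℝ, E) (fun z : M => g • z) x (S.J x u)
  smooth_moment : ∀ K, ContMDiff 𝓘(ℝ, E) 𝓘(ℝ, ℝ) ∞ (fun x => μ x K)
  moment_eq : ∀ K x (v : TangentSpace 𝓘(ℝ, E) x),
    (mfderiv 𝓘(ℝ, E) 𝓘(ℝ, ℝ) (fun x => μ x K) x : E →L[ℝ] ℝ) v = S.symp x (genField K x) v

end Manifold

/-! ### The deformation functions -/

/-- The conditions on the cut-off functions `α̃`, `φ̃`. -/
structure IsCutoffPair (a f : ℝ → ℝ) : Prop where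
  smooth_a : ContDiff ℝ ∞ a
  smooth_f : ContDiff ℝ ∞ f
  a_low : ∀ t ≤ 1 / 3, a t = t ^ 2
  a_high : ∀ t ≥ 2 / 3, a t = 1
  f_low : ∀ t ≤ 1 / 3, f t = 1 - t ^ 3
  f_high : ∀ t ≥ 2 / 3, f t = 2 * (1 - t)
  sum_ge : ∀ t, 1 / 3 ≤ t → t ≤ 2 / 3 → 29 / 27 ≤ a t + f t
  deriv_f_neg : ∀ t, 1 / 3 ≤ t → t ≤ 2 / 3 → deriv f t < 0

/-- `t ↦ a (t / A - 1)`, used for `a = α̃` and `a = φ̃`. -/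
def rescale (a : ℝ → ℝ) (A t : ℝ) : ℝ := a (t / A - 1)

section Functions

variable {d : ℕ}

/-- The inner product of two elements of the Lie algebra given by their components in an
orthonormal basis. -/
def dot (m e : Fin d → ℝ) : ℝ := ∑ i, m i * e i

variable (α φ : ℝ → ℝ) (m e : Fin d → ℝ)

/-! In the following, `m`, `e`, `m + e` are the components of `μ`, `η`, `θ = μ + η`. -/

/-- `β = |μ|² + α(|μ|²) (|θ|² - |μ|²)`. -/
def betaFun : ℝ := dot m m + α (dot m m) * (dot (m + e) (m + e) - dot m m)

/-- `ρ = θ - φ(β) η`. -/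
def rhoFun (j : Fin d) : ℝ := (m + e) j - φ (betaFun α m e) * e j

/-- `γ_j = 2 (1 + α'(|μ|²) (|θ|² - |μ|²)) μ_j + 2 α(|μ|²) η_j`. -/
def gammaFun (j : Fin d) : ℝ :=
  2 * (1 + deriv α (dot m m) * (dot (m + e) (m + e) - dot m m)) * m j + 2 * α (dot m m) * e j

/-- `ψ_j = 2 ρ_j - 2 φ'(β) ⟨ρ, η⟩ γ_j`. -/
def psiFun (j : Fin d) : ℝ :=
  2 * rhoFun α φ m e j - 2 * deriv φ (betaFun α m e) * dot (rhoFun α φ m e) e * gammaFun α m e j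

end Functions

/-! ### The vector field `X^ρ` and the operator `√-1 (I₁ + I₂)` on `M × N` -/

section Product

variable {EG : Type*} [NormedAddCommGroup EG] [NormedSpace ℝ EG]
  {G : Type*} [TopologicalSpace G] [ChartedSpace EG G] [Group G]
  {EM : Type*} [NormedAddCommGroup EM] [NormedSpace ℝ EM]
  {M : Type*} [TopologicalSpace M] [ChartedSpace EM M] [IsManifold 𝓘(ℝ, EM) ∞ M]
  [MulAction G M]
  {EN : Type*} [NormedAddCommGroup EN] [NormedSpace ℝ EN]
  {N : Type*} [TopologicalSpace N] [ChartedSpace EN N] [IsManifold 𝓘(ℝ, EN) ∞ N]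
  [MulAction G N]
  {d : ℕ} (V : Module.Basis (Fin d) ℝ (GroupLieAlgebra 𝓘(ℝ, EG) G))
  (μ : M → (GroupLieAlgebra 𝓘(ℝ, EG) G →L[ℝ] ℝ)) (η : N → (GroupLieAlgebra 𝓘(ℝ, EG) G →L[ℝ] ℝ))

/-- The components `μ_i = μ(V_i)` of a moment map in the basis `V`. -/
def comps {P : Type*} (ν : P → (GroupLieAlgebra 𝓘(ℝ, EG) G →L[ℝ] ℝ)) (x : P) (i : Fin d) : ℝ :=
  ν x (V i)

/-- `{(x, y) : |μ(x)|² ≥ A, |θ(x, y)|² ≤ 2 A}`. -/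
def region (A : ℝ) : Set (M × N) :=
  {p | A ≤ dot (comps V μ p.1) (comps V μ p.1) ∧
    dot (comps V μ p.1 + comps V η p.2) (comps V μ p.1 + comps V η p.2) ≤ 2 * A}

variable (α φ : ℝ → ℝ)

/-- The function `ψ_j` on `M × N`. -/
def psi (j : Fin d) (x : M) (y : N) : ℝ := psiFun α φ (comps V μ x) (comps V η y) j

/-- `X^ρ = ∑_j ψ_j (V_j^M + V_j^N)`, in `T_{(x, y)}(M × N) = T_x M ⊕ T_y N`. -/
def fieldX (x : M) (y : N) : TangentSpace 𝓘(ℝ, EM) x × TangentSpace 𝓘(ℝ, EN) y :=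
  ∑ j, psi V μ η α φ j x y • (genField (V j) x, genField (V j) y)

variable [FiniteDimensional ℝ EM] [FiniteDimensional ℝ EN]
  (SM : AlmostKahler EM M) (SN : AlmostKahler EN N)

/-- `(d^M ψ_j)^*`, in `T_x M`. -/
def gradM (j : Fin d) (x : M) (y : N) : TangentSpace 𝓘(ℝ, EM) x :=
  (SM.tangent x).sharp
    (mfderiv 𝓘(ℝ, EM) 𝓘(ℝ, ℝ) (fun z => psi V μ η α φ j z y) x : EM →L[ℝ] ℝ).toLinearMap

/-- `(d^N ψ_j)^*`, in `T_y N`. -/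
def gradN (j : Fin d) (x : M) (y : N) : TangentSpace 𝓘(ℝ, EN) y :=
  (SN.tangent y).sharp
    (mfderiv 𝓘(ℝ, EN) 𝓘(ℝ, ℝ) (fun z => psi V μ η α φ j x z) y : EN →L[ℝ] ℝ).toLinearMap

/-- The Hermitian structure of `T_{(x, y)}(M × N)`. -/
abbrev prodStr (x : M) (y : N) :
    HermitianStructure (TangentSpace 𝓘(ℝ, EM) x × TangentSpace 𝓘(ℝ, EN) y) :=
  (SM.tangent x).prod (SN.tangent y)

/-- `I₁ = ∑_j (1/4) c((d^M ψ_j)^*) c(V_j^M + 2 V_j^N) + (1/2) c((d^N ψ_j)^*) c(V_j^M)`,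
on `Λ(T^{*(0,1)}(M × N))` at `(x, y)`. -/
def opI1 (x : M) (y : N) : Module.End ℂ (prodStr SM SN x y).Spinor :=
  ∑ j, ((1 / 4 : ℂ) • ((prodStr SM SN x y).cliff (gradM V μ η α φ SM j x y, 0) *
        (prodStr SM SN x y).cliff (genField (V j) x, (2 : ℝ) • genField (V j) y)) +
      (1 / 2 : ℂ) • ((prodStr SM SN x y).cliff (0, gradN V μ η α φ SN j x y) *
        (prodStr SM SN x y).cliff (genField (V j) x, 0)))

/-- `I₂ = ∑_j (1/4) ⟨(1 + J^M / √-1) V_j^M, (d^M ψ_j)^*⟩`, where `⟨·,·⟩` is `ℂ`-bilinear. -/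
def scalarI2 (x : M) (y : N) : ℂ :=
  ∑ j, (1 / 4 : ℂ) *
    (((SM.tangent x).g (genField (V j) x) (gradM V μ η α φ SM j x y) : ℝ) +
      ((SM.tangent x).g (SM.J x (genField (V j) x)) (gradM V μ η α φ SM j x y) : ℝ) / Complex.I)

/-- `√-1 (I₁ + I₂)`. -/
def opI12 (x : M) (y : N) : Module.End ℂ (prodStr SM SN x y).Spinor :=
  Complex.I • (opI1 V μ η α φ SM SN x y + scalarI2 V μ η α φ SM x y • 1)

end Product

end MomentMapDeformation

end

/-! The operator turns out to be a quadratic expression in annihilation and creation operators whose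
leading matrix is close to twice the identity, so that completing the square bounds it from below.

Write `P j k` and `Q j k` for the derivatives of ψ_j in μ_k and η_k. The moment map equation makes J
V_k^M the gradient of μ_k, so (d^M ψ_j)^* = Σ_k P_jk J V_k^M, and likewise on N with Q
(`sharp_mfderiv_comps`). Let a_k be contraction with V_k^M; its adjoint a_k^* is the corresponding
exterior multiplication (`spinorInner_wedge`). Expanding the Clifford products gives √-1 (I₁ + I₂) =
Σ P_jk a_k^* a_j + Σ (a_k^* B_k + B_k^* a_k), where B_k involves only P, Q and the vectors V_j^N
(`cliffOp_eq_quadOp`). Three facts enter this identity: the scalar I₂ cancels the constant produced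
by normal ordering; the remaining terms in M-directions are antisymmetric and vanish against the
symmetric matrix P; directions along M and N anticommute.

P is symmetric because ψ is the μ-gradient of |ρ|², so P is a Hessian (`psiDerivM_symm`). Its size
comes from the scaling ε = A^{-1/2}, n = ε μ: ψ_j - 2 μ_j is a smooth function of (ε, n, η), and
these variables stay in a compact set when |μ|² ≤ 4A. Hence P = 2 Id + O(A^{-1/2}) and Q = O(1)
(`exists_psiDeriv_bound`). The vectors V_j^N are bounded since N is compact, so the B_k are bounded
uniformly in A, x and y. The fields V_j^M may be unbounded, but they occur only through a_k and
a_k^*. For large A the quadratic part is at least Σ |a_k σ|², which absorbs the cross terms at the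
price of Σ |B_k σ|² (`quadOp_ge`). -/

namespace MomentMapDeformation

/-! ### Wedge and contraction on the monomial basis of an exterior algebra. -/

section ExteriorBasis

open Module

variable {R X I : Type*} [CommRing R] [AddCommGroup X] [Module R X] [LinearOrder I]
  (b : Basis I R X)

/-- Contraction of the exterior algebra with a functional. -/
noncomputable def interior (f : Module.Dual R X) : Module.End R (ExteriorAlgebra R X) :=
  CliffordAlgebra.contractLeft (Q := (0 : QuadraticForm R X)) f

theorem interior_ι_mul (f : Module.Dual R X) (x : X) (σ : ExteriorAlgebra R X) :
    interior f (ExteriorAlgebra.ι R x * σ) = f x • σ - ExteriorAlgebra.ι R x * interior f σ :=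
  CliffordAlgebra.contractLeft_ι_mul (Q := (0 : QuadraticForm R X)) f x σ

theorem interior_one (f : Module.Dual R X) : interior f 1 = 0 :=
  CliffordAlgebra.contractLeft_one (0 : QuadraticForm R X) f

theorem interior_comm (f f' : Module.Dual R X) (σ : ExteriorAlgebra R X) :
    interior f (interior f' σ) = -interior f' (interior f σ) :=
  CliffordAlgebra.contractLeft_comm (Q := (0 : QuadraticForm R X)) f f' σ

theorem interior_add (f f' : Module.Dual R X) : interior (f + f') = interior f + interior f' :=
  map_add (CliffordAlgebra.contractLeft (Q := (0 : QuadraticForm R X))) f f'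

theorem interior_smul (c : R) (f : Module.Dual R X) : interior (c • f) = c • interior f :=
  map_smul (CliffordAlgebra.contractLeft (Q := (0 : QuadraticForm R X))) c f

theorem interior_sum {κ : Type*} (s : Finset κ) (f : κ → Module.Dual R X) :
    interior (∑ k ∈ s, f k) = ∑ k ∈ s, interior (f k) :=
  map_sum (CliffordAlgebra.contractLeft (Q := (0 : QuadraticForm R X))) f s

theorem exteriorBasis_empty : b.ExteriorAlgebra ∅ = 1 := by
  rw [ExteriorAlgebra.basis_apply_ofCard b (n := 0) (s := ∅) rfl]
  simp [ExteriorAlgebra.ιMulti_family, ExteriorAlgebra.ιMulti_zero_apply]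

theorem exteriorBasis_singleton (i : I) :
    b.ExteriorAlgebra {i} = ExteriorAlgebra.ι R (b i) := by
  rw [ExteriorAlgebra.basis_apply_ofCard b (n := 1) (s := {i}) rfl]
  simp only [ExteriorAlgebra.ιMulti_family, ExteriorAlgebra.ιMulti_succ_apply,
    ExteriorAlgebra.ιMulti_zero_apply, mul_one, Function.comp_apply]
  congr 2
  exact Finset.mem_singleton.1 (Finset.orderEmbOfFin_mem ({i} : Finset I) _ _)

theorem ι_mul_exteriorBasis_of_mem {i : I} {s : Finset I} (h : i ∈ s) :
    ExteriorAlgebra.ι R (b i) * b.ExteriorAlgebra s = 0 := by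
  rw [← exteriorBasis_singleton]
  exact ExteriorAlgebra.basis_mul_of_not_disjoint b (m := 1) (n := s.card) ⟨{i}, by simp⟩ ⟨s, rfl⟩
    (by simpa using h)

theorem ι_mul_exteriorBasis_of_notMem {i : I} {s : Finset I} (h : i ∉ s) :
    ∃ ε : ℤˣ, ExteriorAlgebra.ι R (b i) * b.ExteriorAlgebra s =
      ε • b.ExteriorAlgebra (insert i s) := by
  rw [← exteriorBasis_singleton]
  have hd : Disjoint ({i} : Finset I) s := by simpa using h
  have h1 := ExteriorAlgebra.basis_mul_of_disjoint b (m := 1) (n := s.card)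
    ⟨{i}, by simp⟩ ⟨s, rfl⟩ hd
  rw [Set.powersetCard.coe_disjUnion, Finset.disjUnion_eq_union, ← Finset.insert_eq] at h1
  exact ⟨_, h1⟩

theorem interior_exteriorBasis_of_notMem {i : I} {s : Finset I} (h : i ∉ s) :
    interior (b.coord i) (b.ExteriorAlgebra s) = 0 := by
  induction s using Finset.induction_on with
  | empty => rw [exteriorBasis_empty, interior_one]
  | insert j s hj ih =>
    obtain ⟨ε, hε⟩ := ι_mul_exteriorBasis_of_notMem b hj
    have hε' : b.ExteriorAlgebra (insert j s) =
        ε • (ExteriorAlgebra.ι R (b j) * b.ExteriorAlgebra s) := by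
      rw [hε, smul_smul, Int.units_mul_self, one_smul]
    have hij : j ≠ i := by rintro rfl; simp at h
    rw [hε', Units.smul_def, map_zsmul, interior_ι_mul,
      ih (fun h' => h (Finset.mem_insert_of_mem h')), mul_zero, sub_zero, b.coord_apply,
      b.repr_self, Finsupp.single_eq_of_ne' hij, zero_smul, smul_zero]

/-- The same sign governs removing e_i and multiplying by it; this is what makes contraction the
transpose of exterior multiplication. -/
theorem interior_exteriorBasis_of_mem {i : I} {s : Finset I} (ε : ℤˣ)
    (hε : ExteriorAlgebra.ι R (b i) * b.ExteriorAlgebra (s.erase i) = ε • b.ExteriorAlgebra s) :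
    interior (b.coord i) (b.ExteriorAlgebra s) = ε • b.ExteriorAlgebra (s.erase i) := by
  have hε' : b.ExteriorAlgebra s =
      ε • (ExteriorAlgebra.ι R (b i) * b.ExteriorAlgebra (s.erase i)) := by
    rw [hε, smul_smul, Int.units_mul_self, one_smul]
  conv_lhs => rw [hε']
  rw [Units.smul_def, map_zsmul, interior_ι_mul,
    interior_exteriorBasis_of_notMem b (Finset.notMem_erase i s), mul_zero, sub_zero,
    b.coord_apply, b.repr_self, Finsupp.single_eq_same, one_smul, Units.smul_def]

end ExteriorBasis

/-! ### The (0,1)-spinors: complex linearity, commutation relations and adjoints. -/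

namespace HermitianStructure

variable {V : Type*} [AddCommGroup V] [Module ℝ V] (S : HermitianStructure V)

theorem J_skew (u v : V) : S.g (S.J u) v = -S.g u (S.J v) := by
  have h := S.g_J u (S.J v)
  rw [S.J_sq, map_neg] at h
  linarith

/-- Exterior multiplication by `dual01 v`. -/
noncomputable def wedge (v : V) : Module.End ℂ S.Spinor :=
  LinearMap.mulLeft ℂ (ExteriorAlgebra.ι ℂ (S.dual01 v))

/-- Contraction with `eval01 v`. -/
noncomputable def contract (v : V) : Module.End ℂ S.Spinor := interior (S.eval01 v)

theorem cliff_eq (v : V) :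
    S.cliff v = ((Real.sqrt 2 : ℝ) : ℂ) • (S.wedge v - S.contract v) := rfl

theorem dual01_add (u v : V) : S.dual01 (u + v) = S.dual01 u + S.dual01 v := by
  apply Subtype.ext; ext w
  simp [dual01]; ring

theorem dual01_smul (c : ℝ) (v : V) : S.dual01 (c • v) = (c : ℂ) • S.dual01 v := by
  apply Subtype.ext; ext w
  simp [dual01]; ring

/-- Since v ↦ w is complex linear and v ↦ w̄ antilinear, J becomes √-1 in `dual01` and -√-1 in
`eval01`. This turns the difference in c(v) into a sum in c(J v). -/
theorem dual01_J (v : V) : S.dual01 (S.J v) = Complex.I • S.dual01 v := by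
  apply Subtype.ext; ext w
  simp [dual01, S.J_sq]
  linear_combination ((S.g (S.J v) w : ℂ) / 2) * Complex.I_sq

theorem eval01_add (u v : V) : S.eval01 (u + v) = S.eval01 u + S.eval01 v := by
  ext f; simp [eval01]

theorem eval01_smul (c : ℝ) (v : V) : S.eval01 (c • v) = (c : ℂ) • S.eval01 v := by
  ext f; simp [eval01]

theorem eval01_J (v : V) : S.eval01 (S.J v) = (-Complex.I) • S.eval01 v := by
  ext f
  exact f.2 v

theorem wedge_add (u v : V) : S.wedge (u + v) = S.wedge u + S.wedge v := by
  ext; simp [wedge, dual01_add, add_mul]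

theorem wedge_smul (c : ℝ) (v : V) : S.wedge (c • v) = (c : ℂ) • S.wedge v := by
  ext; simp [wedge, dual01_smul]

theorem wedge_J (v : V) : S.wedge (S.J v) = Complex.I • S.wedge v := by
  ext; simp [wedge, dual01_J]

theorem contract_add (u v : V) : S.contract (u + v) = S.contract u + S.contract v := by
  simp [contract, eval01_add, interior_add]

theorem contract_smul (c : ℝ) (v : V) : S.contract (c • v) = (c : ℂ) • S.contract v := by
  rw [contract, eval01_smul, interior_smul]; rfl

theorem contract_J (v : V) : S.contract (S.J v) = (-Complex.I) • S.contract v := by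
  rw [contract, eval01_J, interior_smul]; rfl

theorem cliff_J (v : V) :
    S.cliff (S.J v) = ((Real.sqrt 2 : ℝ) : ℂ) • Complex.I • (S.wedge v + S.contract v) := by
  rw [cliff_eq, wedge_J, contract_J]
  congr 1
  module

theorem cliff_add (u v : V) : S.cliff (u + v) = S.cliff u + S.cliff v := by
  simp only [cliff_eq, wedge_add, contract_add, ← smul_add]; congr 1; abel

theorem cliff_smul (c : ℝ) (v : V) : S.cliff (c • v) = (c : ℂ) • S.cliff v := by
  rw [cliff_eq, cliff_eq, wedge_smul, contract_smul]
  module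

theorem eval01_dual01 (u v : V) :
    S.eval01 u (S.dual01 v) = ((S.g v u : ℝ) - Complex.I * (S.g (S.J v) u : ℝ)) / 2 := rfl

theorem contract_mul_wedge (u v : V) :
    S.contract u * S.wedge v = (S.eval01 u (S.dual01 v)) • 1 - S.wedge v * S.contract u := by
  apply LinearMap.ext
  intro σ
  exact interior_ι_mul _ _ σ

theorem contract_mul_contract (u v : V) :
    S.contract u * S.contract v = - (S.contract v * S.contract u) := by
  apply LinearMap.ext
  intro σ
  exact interior_comm _ _ σ

theorem wedge_mul_wedge (u v : V) :
    S.wedge u * S.wedge v = - (S.wedge v * S.wedge u) := by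
  apply LinearMap.ext
  intro σ
  have h := ExteriorAlgebra.ι_add_mul_swap (R := ℂ) (S.dual01 u) (S.dual01 v)
  simp only [wedge, Module.End.mul_apply, LinearMap.neg_apply, LinearMap.mulLeft_apply,
    ← mul_assoc]
  rw [eq_neg_of_add_eq_zero_left h, neg_mul]

variable [FiniteDimensional ℝ V]

theorem spinorInner_add_left (σ σ' τ : S.Spinor) :
    S.spinorInner (σ + σ') τ = S.spinorInner σ τ + S.spinorInner σ' τ := by
  simp [spinorInner, add_mul, Finset.sum_add_distrib]

theorem spinorInner_smul_left (c : ℂ) (σ τ : S.Spinor) :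
    S.spinorInner (c • σ) τ = conj c * S.spinorInner σ τ := by
  simp [spinorInner, Finset.mul_sum, mul_assoc]

theorem spinorInner_conj (σ τ : S.Spinor) :
    conj (S.spinorInner σ τ) = S.spinorInner τ σ := by
  simp only [spinorInner, map_sum, map_mul, Complex.conj_conj]
  exact Finset.sum_congr rfl fun _ _ => mul_comm _ _

theorem spinorInner_add_right (σ τ τ' : S.Spinor) :
    S.spinorInner σ (τ + τ') = S.spinorInner σ τ + S.spinorInner σ τ' := by
  simp [spinorInner, mul_add, Finset.sum_add_distrib]

theorem spinorInner_smul_right (c : ℂ) (σ τ : S.Spinor) :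
    S.spinorInner σ (c • τ) = c * S.spinorInner σ τ := by
  simp only [spinorInner, Finset.mul_sum, map_smul, Finsupp.smul_apply, smul_eq_mul]
  exact Finset.sum_congr rfl fun _ _ => by ring

/-- The metric `spinorInner` as an inner product space core. -/
noncomputable abbrev spinorCore : InnerProductSpace.Core ℂ S.Spinor where
  inner := S.spinorInner
  conj_inner_symm σ τ := S.spinorInner_conj τ σ
  re_inner_nonneg σ := by
    simp only [spinorInner, ← Complex.normSq_eq_conj_mul_self, map_sum]
    exact Finset.sum_nonneg fun s _ => Complex.normSq_nonneg _
  add_left := S.spinorInner_add_left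
  smul_left σ τ c := S.spinorInner_smul_left c σ τ
  definite σ h := by
    change S.spinorInner σ σ = 0 at h
    simp only [spinorInner, ← Complex.normSq_eq_conj_mul_self, ← Complex.ofReal_sum] at h
    rw [Complex.ofReal_eq_zero,
      Finset.sum_eq_zero_iff_of_nonneg fun _ _ => Complex.normSq_nonneg _] at h
    apply S.covBasis.ExteriorAlgebra.repr.injective
    ext s
    simpa using h s (Finset.mem_univ s)

theorem covBasis_orthonormal (i j) :
    S.covInner (S.covBasis i) (S.covBasis j) = if i = j then 1 else 0 :=
  S.exists_orthonormal_basis.choose_spec i j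

theorem spinorInner_basis (s t) :
    S.spinorInner (S.covBasis.ExteriorAlgebra s) (S.covBasis.ExteriorAlgebra t) =
      if s = t then 1 else 0 := by
  simp [spinorInner, Finsupp.single_apply]

/-- Both sides vanish unless i ∉ s and t = s ∪ {i}, and then each is the sign in e_i ∧ e_s = ± e_t.
-/
theorem spinorInner_ι_mul_basis (i s t) :
    S.spinorInner (ExteriorAlgebra.ι ℂ (S.covBasis i) * S.covBasis.ExteriorAlgebra s)
        (S.covBasis.ExteriorAlgebra t) =
      S.spinorInner (S.covBasis.ExteriorAlgebra s)
        (interior (S.covBasis.coord i) (S.covBasis.ExteriorAlgebra t)) := by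
  have hz : ∀ (ε : ℤˣ) (σ : S.Spinor), ε • σ = ((ε : ℤ) : ℂ) • σ := fun ε σ => by
    rw [Units.smul_def, Int.cast_smul_eq_zsmul]
  by_cases hs : i ∈ s
  · rw [ι_mul_exteriorBasis_of_mem _ hs]
    by_cases ht : i ∈ t
    · obtain ⟨ε, hε⟩ := ι_mul_exteriorBasis_of_notMem S.covBasis (Finset.notMem_erase i t)
      rw [Finset.insert_erase ht] at hε
      rw [interior_exteriorBasis_of_mem _ ε hε]
      rw [hz, spinorInner_smul_right, spinorInner_basis, if_neg]
      · simp [spinorInner]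
      · rintro rfl; simp at hs
    · rw [interior_exteriorBasis_of_notMem _ ht]
      simp [spinorInner]
  · obtain ⟨δ, hδ⟩ := ι_mul_exteriorBasis_of_notMem S.covBasis hs
    rw [hδ, hz, spinorInner_smul_left, spinorInner_basis]
    by_cases ht : i ∈ t
    · obtain ⟨ε, hε⟩ := ι_mul_exteriorBasis_of_notMem S.covBasis (Finset.notMem_erase i t)
      rw [Finset.insert_erase ht] at hε
      rw [interior_exteriorBasis_of_mem _ ε hε]
      rw [hz, spinorInner_smul_right, spinorInner_basis]
      by_cases h : s = t.erase i
      · subst h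
        rw [Finset.insert_erase ht] at hδ ⊢
        -- Both signs describe the same product; pairing it with the unit vector e_t identifies
        -- them.
        have : δ = ε := by
          have h1 := hδ.symm.trans hε
          have h2 := congrArg (S.spinorInner (S.covBasis.ExteriorAlgebra t)) h1
          rw [hz, hz, spinorInner_smul_right, spinorInner_smul_right, spinorInner_basis] at h2
          simp only [if_true, mul_one] at h2
          exact Units.ext (by exact_mod_cast h2)
        subst this
        simp
      · rw [if_neg h, if_neg]
        · simp
        · rintro rfl
          exact h (Finset.erase_insert hs).symm
    · rw [interior_exteriorBasis_of_notMem _ ht, if_neg]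
      · simp [spinorInner]
      · rintro rfl; simp at ht

theorem eval01_eq_covInner (v : V) (f : S.Covector01) :
    S.eval01 v f = S.covInner (S.dual01 v) f := by
  have h : (2 : ℝ) • S.sharp (Complex.reLm ∘ₗ (S.dual01 v).1) = v := by
    apply (LinearMap.BilinForm.toDual S.g S.nondegenerate).injective
    ext u
    rw [LinearMap.BilinForm.toDual_def, LinearMap.BilinForm.toDual_def, map_smul,
      LinearMap.smul_apply, g_sharp]
    simp [dual01]
    ring
  rw [covInner, h]
  rfl

theorem covInner_conj (f f' : S.Covector01) : conj (S.covInner f f') = S.covInner f' f := by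
  rw [S.eq_dual01 f, S.eq_dual01 f', covInner_dual01, covInner_dual01]
  simp only [map_div₀, map_sub, map_mul, Complex.conj_ofReal, Complex.conj_I]
  rw [S.symm, J_skew, S.symm _ (S.J _)]
  simp only [map_ofNat]
  push_cast
  ring

/-- The coefficients are conjugated because evaluation at v is the pairing with `dual01 v` in the
antilinear slot. These conjugates match those produced by moving `wedge v` across the metric. -/
theorem eval01_eq_sum (v : V) :
    S.eval01 v = ∑ i, conj (S.covBasis.repr (S.dual01 v) i) • S.covBasis.coord i := by
  apply S.covBasis.ext
  intro j
  rw [eval01_eq_covInner, ← covInner_conj]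
  conv_lhs => rw [← S.covBasis.sum_repr (S.dual01 v)]
  rw [covInner]
  change conj (S.eval01 _ _) = _
  rw [map_sum, map_sum]
  have : ∀ i, S.eval01 ((2 : ℝ) • S.sharp (Complex.reLm ∘ₗ (S.covBasis j).1)) (S.covBasis i) =
    if j = i then 1 else 0 := fun i => S.covBasis_orthonormal j i
  simp [this, Finsupp.single_apply, apply_ite conj]

/-- Exterior multiplication is adjoint to contraction. -/
theorem spinorInner_wedge (v : V) (σ τ : S.Spinor) :
    S.spinorInner (S.wedge v σ) τ = S.spinorInner σ (S.contract v τ) := by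
  -- The metric with its arguments exchanged, as a sesquilinear map, so that adjointness can be
  -- checked on basis vectors.
  let ℓ : S.Spinor →ₗ[ℂ] S.Spinor →ₗ⋆[ℂ] ℂ := LinearMap.mk₂'ₛₗ (RingHom.id ℂ) (starRingEnd ℂ)
    (fun τ σ => S.spinorInner σ τ)
    (fun a b c => S.spinorInner_add_right c a b) (fun c a b => S.spinorInner_smul_right c b a)
    (fun a b c => S.spinorInner_add_left b c a) (fun c a b => S.spinorInner_smul_left c b a)
  have key : ∀ i, ℓ.compl₂ (LinearMap.mulLeft ℂ (ExteriorAlgebra.ι ℂ (S.covBasis i))) =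
      ℓ ∘ₗ (interior (S.covBasis.coord i)) := by
    intro i
    apply S.covBasis.ExteriorAlgebra.ext
    intro t
    apply S.covBasis.ExteriorAlgebra.ext
    intro s
    exact S.spinorInner_ι_mul_basis i s t
  have key' : ∀ i, S.spinorInner (ExteriorAlgebra.ι ℂ (S.covBasis i) * σ) τ =
      S.spinorInner σ (interior (S.covBasis.coord i) τ) := fun i =>
    LinearMap.congr_fun (LinearMap.congr_fun (key i) τ) σ
  have h1 : S.wedge v σ = ∑ i, S.covBasis.repr (S.dual01 v) i •
      (ExteriorAlgebra.ι ℂ (S.covBasis i) * σ) := by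
    simp only [wedge, LinearMap.mulLeft_apply]
    conv_lhs => rw [← S.covBasis.sum_repr (S.dual01 v)]
    simp only [map_sum, map_smul, Finset.sum_mul, smul_mul_assoc]
  have h2 : S.contract v τ = ∑ i, conj (S.covBasis.repr (S.dual01 v) i) •
      (interior (S.covBasis.coord i) τ) := by
    simp only [contract]
    rw [eval01_eq_sum, interior_sum]
    simp only [interior_smul, LinearMap.sum_apply, LinearMap.smul_apply]
  change ℓ τ _ = ℓ _ σ
  rw [h1, h2, map_sum, map_sum, LinearMap.sum_apply]
  refine Finset.sum_congr rfl fun i _ => ?_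
  rw [map_smulₛₗ, map_smul, LinearMap.smul_apply]
  exact congrArg _ (key' i)

end HermitianStructure

/-! ### Derivatives of ψ: symmetry and asymptotics for large A. -/

section Calculus

variable {d : ℕ}

theorem dot_add_left (u v w : Fin d → ℝ) : dot (u + v) w = dot u w + dot v w := by
  simp [dot, add_mul, Finset.sum_add_distrib]

theorem dot_smul_left (c : ℝ) (u v : Fin d → ℝ) : dot (c • u) v = c * dot u v := by
  simp [dot, Finset.mul_sum, mul_assoc]

theorem dot_comm (u v : Fin d → ℝ) : dot u v = dot v u := by
  simp [dot, mul_comm]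

theorem dot_add_right (u v w : Fin d → ℝ) : dot u (v + w) = dot u v + dot u w := by
  rw [dot_comm, dot_add_left, dot_comm v, dot_comm w]

theorem dot_smul_right (c : ℝ) (u v : Fin d → ℝ) : dot u (c • v) = c * dot u v := by
  rw [dot_comm, dot_smul_left, dot_comm]

theorem abs_le_of_dot_le {u : Fin d → ℝ} {c : ℝ} (hc : 0 ≤ c) (h : dot u u ≤ c ^ 2) (i : Fin d) :
    |u i| ≤ c := by
  refine abs_le_of_sq_le_sq ?_ hc
  refine le_trans ?_ h
  rw [sq]
  exact Finset.single_le_sum (f := fun i => u i * u i) (fun i _ => mul_self_nonneg _)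
    (Finset.mem_univ i)

theorem contDiff_dot {X : Type*} [NormedAddCommGroup X] [NormedSpace ℝ X] {n : WithTop ℕ∞}
    {u v : X → Fin d → ℝ} (hu : ContDiff ℝ n u) (hv : ContDiff ℝ n v) :
    ContDiff ℝ n fun x => dot (u x) (v x) :=
  ContDiff.sum fun i _ => (contDiff_pi.1 hu i).mul (contDiff_pi.1 hv i)

/-- The linear form `dot u`. -/
def dotL (u : Fin d → ℝ) : (Fin d → ℝ) →L[ℝ] ℝ :=
  ∑ i, u i • ContinuousLinearMap.proj (R := ℝ) (φ := fun _ : Fin d => ℝ) i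

theorem dotL_apply (u v : Fin d → ℝ) : dotL u v = dot u v := by
  simp [dotL, dot]

theorem hasFDerivAt_dot_self (m : Fin d → ℝ) :
    HasFDerivAt (fun m => dot m m) ((2 : ℝ) • dotL m) m := by
  have h : ∀ i, HasFDerivAt (fun m : Fin d → ℝ => m i * m i)
      (m i • ContinuousLinearMap.proj (R := ℝ) (φ := fun _ : Fin d => ℝ) i +
        m i • ContinuousLinearMap.proj (R := ℝ) (φ := fun _ : Fin d => ℝ) i) m := fun i =>
    (hasFDerivAt_apply i m).mul (hasFDerivAt_apply i m)
  have := HasFDerivAt.fun_sum (u := Finset.univ) fun i _ => h i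
  refine this.congr_fderiv ?_
  simp only [dotL, Finset.smul_sum, two_smul, Finset.sum_add_distrib]

theorem hasFDerivAt_dot_right (e m : Fin d → ℝ) :
    HasFDerivAt (fun m => dot m e) (dotL e) m := by
  have : (fun m => dot m e) = dotL e := by
    ext m; rw [dotL_apply, dot_comm]
  rw [this]
  exact (dotL e).hasFDerivAt

variable {α φ : ℝ → ℝ}

theorem hasFDerivAt_betaFun (hα : ContDiff ℝ ∞ α) (m e : Fin d → ℝ) :
    HasFDerivAt (fun m => betaFun α m e) (dotL (gammaFun α m e)) m := by
  have hθ : ∀ m : Fin d → ℝ, dot (m + e) (m + e) - dot m m = 2 * dot m e + dot e e := fun m => by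
    simp only [dot_add_left, dot_add_right, dot_comm e m]; ring
  have hα' : HasFDerivAt (fun m => α (dot m m)) (deriv α (dot m m) • (2 : ℝ) • dotL m) m :=
    HasDerivAt.comp_hasFDerivAt (f := fun m => dot m m) m
      (hα.differentiable (by simp)).differentiableAt.hasDerivAt (hasFDerivAt_dot_self m)
  have h := (hasFDerivAt_dot_self m).add (hα'.mul
    (((hasFDerivAt_dot_right e m).const_mul 2).add_const (dot e e)))
  have hfun : (fun m => betaFun α m e) =
      (fun m => dot m m) + (fun m => α (dot m m) * (2 * dot m e + dot e e)) := by
    ext m; simp only [betaFun, hθ, Pi.add_apply]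
  rw [hfun]
  refine h.congr_fderiv ?_
  ext v
  have hg : gammaFun α m e = (2 * (1 + deriv α (dot m m) * (2 * dot m e + dot e e))) • m +
      (2 * α (dot m m)) • e := by
    ext j; simp [gammaFun, hθ]
  simp only [dotL_apply, hg, add_apply, smul_apply, smul_eq_mul, dot_add_left, dot_smul_left]
  ring

theorem rhoFun_eq (m e : Fin d → ℝ) :
    rhoFun α φ m e = m + (1 - φ (betaFun α m e)) • e := by
  ext j; simp [rhoFun]; ring

/-- `ψ` is the gradient of `|ρ|²` with respect to `μ`. -/
theorem hasFDerivAt_normSq_rhoFun (hα : ContDiff ℝ ∞ α) (hφ : ContDiff ℝ ∞ φ) (m e : Fin d → ℝ) :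
    HasFDerivAt (fun m => dot (rhoFun α φ m e) (rhoFun α φ m e)) (dotL (psiFun α φ m e)) m := by
  have hφ' : HasFDerivAt (fun m => 1 - φ (betaFun α m e))
      (-(deriv φ (betaFun α m e) • dotL (gammaFun α m e))) m :=
    (((hφ.differentiable (by simp)).differentiableAt.hasDerivAt
      (x := betaFun α m e)).comp_hasFDerivAt m (hasFDerivAt_betaFun hα m e)).const_sub 1
  have h := ((hasFDerivAt_dot_self m).add ((hφ'.mul (hasFDerivAt_dot_right e m)).const_mul 2)).add
    ((hφ'.mul hφ').mul_const (dot e e))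
  have hfun : (fun m => dot (rhoFun α φ m e) (rhoFun α φ m e)) =
      (fun m => dot m m) + (fun m => 2 * ((1 - φ (betaFun α m e)) * dot m e)) +
        fun m => (1 - φ (betaFun α m e)) * (1 - φ (betaFun α m e)) * dot e e := by
    ext m
    simp only [rhoFun_eq, Pi.add_apply, dot_add_left, dot_add_right, dot_smul_left,
      dot_smul_right, dot_comm e m]
    ring
  rw [hfun]
  refine h.congr_fderiv ?_
  ext v
  have hp : psiFun α φ m e = (2 : ℝ) • rhoFun α φ m e +
      (-(2 * deriv φ (betaFun α m e) * dot (rhoFun α φ m e) e)) • gammaFun α m e := by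
    ext j; simp [psiFun]; ring
  simp only [dotL_apply, hp, rhoFun_eq, add_apply, smul_apply, neg_apply, smul_eq_mul,
    dot_add_left, dot_smul_left]
  ring

theorem contDiff_psiFun (hα : ContDiff ℝ ∞ α) (hφ : ContDiff ℝ ∞ φ) (j : Fin d) :
    ContDiff ℝ ∞ fun p : (Fin d → ℝ) × (Fin d → ℝ) => psiFun α φ p.1 p.2 j := by
  have hm : ContDiff ℝ ∞ fun p : (Fin d → ℝ) × (Fin d → ℝ) => p.1 := contDiff_fst
  have he : ContDiff ℝ ∞ fun p : (Fin d → ℝ) × (Fin d → ℝ) => p.2 := contDiff_snd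
  have hα' : ContDiff ℝ ∞ (deriv α) := hα.deriv'
  have hφ' : ContDiff ℝ ∞ (deriv φ) := hφ.deriv'
  have hmm := contDiff_dot hm hm
  have hθ := (contDiff_dot (hm.add he) (hm.add he)).sub hmm
  have hβ : ContDiff ℝ ∞ fun p : (Fin d → ℝ) × (Fin d → ℝ) => betaFun α p.1 p.2 :=
    hmm.add ((hα.comp hmm).mul hθ)
  have hρ : ∀ i, ContDiff ℝ ∞ fun p : (Fin d → ℝ) × (Fin d → ℝ) => rhoFun α φ p.1 p.2 i := fun i =>
    (contDiff_pi.1 (hm.add he) i).sub ((hφ.comp hβ).mul (contDiff_pi.1 he i))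
  have hγ : ContDiff ℝ ∞ fun p : (Fin d → ℝ) × (Fin d → ℝ) => gammaFun α p.1 p.2 j :=
    ((contDiff_const.mul (contDiff_const.add ((hα'.comp hmm).mul hθ))).mul
      (contDiff_pi.1 hm j)).add ((contDiff_const.mul (hα.comp hmm)).mul (contDiff_pi.1 he j))
  exact (contDiff_const.mul (hρ j)).sub (((contDiff_const.mul (hφ'.comp hβ)).mul
    (contDiff_dot (contDiff_pi.2 hρ) he)).mul hγ)

/-- The partial derivative `∂ψ_j / ∂μ_k`. -/
noncomputable def psiDerivM (α φ : ℝ → ℝ) (m e : Fin d → ℝ) (j k : Fin d) : ℝ :=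
  fderiv ℝ (fun m => psiFun α φ m e j) m (Pi.single k 1)

/-- The partial derivative `∂ψ_j / ∂η_k`. -/
noncomputable def psiDerivN (α φ : ℝ → ℝ) (m e : Fin d → ℝ) (j k : Fin d) : ℝ :=
  fderiv ℝ (fun e => psiFun α φ m e j) e (Pi.single k 1)

theorem differentiable_psiFun_left (hα : ContDiff ℝ ∞ α) (hφ : ContDiff ℝ ∞ φ) (e : Fin d → ℝ)
    (j : Fin d) : Differentiable ℝ fun m => psiFun α φ m e j :=
  ((contDiff_psiFun hα hφ j).comp (contDiff_id.prodMk contDiff_const)).differentiable (by simp)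

theorem differentiable_psiFun_right (hα : ContDiff ℝ ∞ α) (hφ : ContDiff ℝ ∞ φ) (m : Fin d → ℝ)
    (j : Fin d) : Differentiable ℝ fun e => psiFun α φ m e j :=
  ((contDiff_psiFun hα hφ j).comp (contDiff_const.prodMk contDiff_id)).differentiable (by simp)

/-- The matrix is the Hessian of |ρ|² in the variable μ. -/
theorem psiDerivM_symm (hα : ContDiff ℝ ∞ α) (hφ : ContDiff ℝ ∞ φ) (m e : Fin d → ℝ)
    (j k : Fin d) : psiDerivM α φ m e j k = psiDerivM α φ m e k j := by
  have h2 : HasFDerivAt (fun m => dotL (psiFun α φ m e))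
      (∑ i, (fderiv ℝ (fun m => psiFun α φ m e i) m).smulRight
        (ContinuousLinearMap.proj (R := ℝ) (φ := fun _ : Fin d => ℝ) i)) m :=
    HasFDerivAt.fun_sum fun i _ =>
      HasFDerivAt.smul_const (F := (Fin d → ℝ) →L[ℝ] ℝ)
        ((differentiable_psiFun_left hα hφ e i) m).hasFDerivAt _
  have h := second_derivative_symmetric (hasFDerivAt_normSq_rhoFun hα hφ · e) h2
    (Pi.single k 1) (Pi.single j 1)
  simpa [Pi.single_apply, psiDerivM] using h

/-- `ψ_j - 2 μ_j` in terms of `ε = A^{-1/2}`, `n = A^{-1/2} μ` and `e = η`. -/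
noncomputable def scaledPsi (a f : ℝ → ℝ) (j : Fin d) (p : ℝ × (Fin d → ℝ) × (Fin d → ℝ)) : ℝ :=
  let D := 2 * dot p.2.1 p.2.2 + p.1 * dot p.2.2 p.2.2
  let t := dot p.2.1 p.2.1 - 1
  let b := t + p.1 * a t * D
  2 * (1 - f b) * p.2.2 j - 2 * deriv f b * (dot p.2.1 p.2.2 + p.1 * (1 - f b) * dot p.2.2 p.2.2) *
    (2 * (1 + p.1 * deriv a t * D) * p.2.1 j + 2 * p.1 * a t * p.2.2 j)

theorem contDiff_scaledPsi {a f : ℝ → ℝ} (ha : ContDiff ℝ ∞ a) (hf : ContDiff ℝ ∞ f) (j : Fin d) :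
    ContDiff ℝ ∞ (scaledPsi a f j) := by
  have hε : ContDiff ℝ ∞ fun p : ℝ × (Fin d → ℝ) × (Fin d → ℝ) => p.1 := contDiff_fst
  have hn : ContDiff ℝ ∞ fun p : ℝ × (Fin d → ℝ) × (Fin d → ℝ) => p.2.1 :=
    contDiff_fst.comp contDiff_snd
  have he : ContDiff ℝ ∞ fun p : ℝ × (Fin d → ℝ) × (Fin d → ℝ) => p.2.2 :=
    contDiff_snd.comp contDiff_snd
  have ha' : ContDiff ℝ ∞ (deriv a) := ha.deriv'
  have hf' : ContDiff ℝ ∞ (deriv f) := hf.deriv'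
  have hne := contDiff_dot hn he
  have hee := contDiff_dot he he
  have hnj := contDiff_pi.1 hn j
  have hej := contDiff_pi.1 he j
  have hD := (contDiff_const (c := (2 : ℝ))).mul hne |>.add (hε.mul hee)
  have ht := (contDiff_dot hn hn).sub (contDiff_const (c := (1 : ℝ)))
  have hb := ht.add ((hε.mul (ha.comp ht)).mul hD)
  have h1f := (contDiff_const (c := (1 : ℝ))).sub (hf.comp hb)
  exact ((contDiff_const.mul h1f).mul hej).sub (((contDiff_const.mul (hf'.comp hb)).mul
    (hne.add ((hε.mul h1f).mul hee))).mul
      (((contDiff_const.mul (contDiff_const.add ((hε.mul (ha'.comp ht)).mul hD))).mul hnj).add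
        (((contDiff_const.mul hε).mul (ha.comp ht)).mul hej)))

theorem deriv_rescale (a : ℝ → ℝ) (A t : ℝ) :
    deriv (rescale a A) t = A⁻¹ * deriv a (t / A - 1) := by
  have h := deriv_comp_mul_left A⁻¹ (fun s => a (s - 1)) t
  rw [deriv_comp_sub_const] at h
  have hr : rescale a A = fun t => a (A⁻¹ * t - 1) := by
    ext s; rw [rescale, div_eq_inv_mul]
  rw [hr, h, smul_eq_mul, div_eq_inv_mul]

theorem contDiff_rescale {a : ℝ → ℝ} (ha : ContDiff ℝ ∞ a) (A : ℝ) :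
    ContDiff ℝ ∞ (rescale a A) :=
  ha.comp ((contDiff_id.div_const A).sub contDiff_const)

/-- With A = ε⁻², the factor ε² in φ' compensates the growth ε⁻¹ of each of ⟨ρ, η⟩ and γ. No
negative power of ε survives, so the remainder stays smooth down to ε = 0. -/
theorem psiFun_rescale (a f : ℝ → ℝ) (ε : ℝ) (m e : Fin d → ℝ) (j : Fin d) :
    psiFun (rescale a (ε⁻¹ ^ 2)) (rescale f (ε⁻¹ ^ 2)) m e j =
      2 * m j + scaledPsi a f j (ε, ε • m, e) := by
  have hθ : dot (m + e) (m + e) - dot m m = 2 * dot m e + dot e e := by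
    simp only [dot_add_left, dot_add_right, dot_comm e m]; ring
  have ht : dot m m / ε⁻¹ ^ 2 - 1 = dot (ε • m) (ε • m) - 1 := by
    rw [dot_smul_left, dot_smul_right]; field_simp
  have hb : betaFun (rescale a (ε⁻¹ ^ 2)) m e / ε⁻¹ ^ 2 - 1 = dot (ε • m) (ε • m) - 1 +
      ε * a (dot (ε • m) (ε • m) - 1) * (2 * dot (ε • m) e + ε * dot e e) := by
    rw [betaFun, hθ, rescale, ht, dot_smul_left _ _ e]
    generalize a _ = z
    rw [dot_smul_left, dot_smul_right]
    field_simp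
    ring
  rw [psiFun, rhoFun_eq, dot_add_left, dot_smul_left, deriv_rescale, gammaFun, deriv_rescale, hθ]
  simp only [scaledPsi, Pi.add_apply, Pi.smul_apply, smul_eq_mul]
  rw [rescale, rescale, hb, ht, dot_smul_left _ _ e]
  generalize dot (ε • m) (ε • m) - 1 = t
  generalize hB : t + ε * a t * (2 * (ε * dot m e) + ε * dot e e) = b
  field_simp
  ring

/-- The derivatives of `scaledPsi` are bounded on a fixed ball independent of A. A derivative in μ
gains a factor ε = A^{-1/2} by the chain rule; a derivative in η gains none. -/
theorem exists_psiDeriv_bound {a f : ℝ → ℝ} (ha : ContDiff ℝ ∞ a) (hf : ContDiff ℝ ∞ f) (c : ℝ) :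
    ∃ K > 0, ∀ A ≥ 1, ∀ m e : Fin d → ℝ, dot m m ≤ 4 * A → (∀ i, |e i| ≤ c) → ∀ j k,
      |psiDerivM (rescale a A) (rescale f A) m e j k - if j = k then 2 else 0| ≤ K / √A ∧
        |psiDerivN (rescale a A) (rescale f A) m e j k| ≤ K := by
  have hcomp : IsCompact (Metric.closedBall (0 : ℝ × (Fin d → ℝ) × (Fin d → ℝ)) (max 2 |c|)) :=
    isCompact_closedBall _ _
  have hbd : ∀ (v : ℝ × (Fin d → ℝ) × (Fin d → ℝ)) (j : Fin d), ∃ K, ∀ p ∈ Metric.closedBall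
      (0 : ℝ × (Fin d → ℝ) × (Fin d → ℝ)) (max 2 |c|), |fderiv ℝ (scaledPsi a f j) p v| ≤ K := by
    intro v j
    have hcont : Continuous fun p => fderiv ℝ (scaledPsi a f j) p v :=
      ((contDiff_scaledPsi ha hf j).continuous_fderiv (by simp)).clm_apply continuous_const
    exact hcomp.exists_bound_of_continuousOn hcont.continuousOn
  choose K hK using hbd
  let v1 : Fin d → ℝ × (Fin d → ℝ) × (Fin d → ℝ) := fun k => (0, Pi.single k 1, 0)
  let v2 : Fin d → ℝ × (Fin d → ℝ) × (Fin d → ℝ) := fun k => (0, 0, Pi.single k 1)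
  let K0 : ℝ := 1 + ∑ j, ∑ k, (|K (v1 k) j| + |K (v2 k) j|)
  have hle : ∀ j k, |K (v1 k) j| + |K (v2 k) j| ≤ K0 := fun j k => by
    have h1 := Finset.single_le_sum (f := fun j => ∑ k, (|K (v1 k) j| + |K (v2 k) j|))
      (fun j _ => by positivity) (Finset.mem_univ j)
    have h2 := Finset.single_le_sum (f := fun k => |K (v1 k) j| + |K (v2 k) j|)
      (fun j _ => by positivity) (Finset.mem_univ k)
    simp only [K0]
    linarith
  refine ⟨K0, by positivity, fun A hA m e hm he j k => ?_⟩
  have hA0 : 0 < A := by linarith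
  obtain ⟨ε, hε, hε1, rfl⟩ : ∃ ε : ℝ, 0 < ε ∧ ε ≤ 1 ∧ A = ε⁻¹ ^ 2 := by
    refine ⟨(√A)⁻¹, by positivity, inv_le_one_of_one_le₀ (Real.one_le_sqrt.2 hA), ?_⟩
    rw [inv_inv, Real.sq_sqrt hA0.le]
  have hsq : √(ε⁻¹ ^ 2) = ε⁻¹ := Real.sqrt_sq (by positivity)
  -- The norm is the sup norm: ε ≤ 1, the entries of ε μ are at most 2 since |μ|² ≤ 4A, and those of
  -- η are at most c.
  have hmem : (ε, ε • m, e) ∈ Metric.closedBall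
      (0 : ℝ × (Fin d → ℝ) × (Fin d → ℝ)) (max 2 |c|) := by
    rw [mem_closedBall_zero_iff, Prod.norm_def, Prod.norm_def]
    refine max_le ?_ (max_le ?_ ?_)
    · rw [Real.norm_eq_abs, abs_of_pos hε]
      exact le_max_of_le_left (by linarith)
    · refine le_max_of_le_left ((pi_norm_le_iff_of_nonneg (by norm_num)).2 fun i => ?_)
      refine abs_le_of_dot_le (by norm_num) ?_ i
      rw [dot_smul_left, dot_smul_right]
      calc ε * (ε * dot m m) ≤ ε * (ε * (4 * ε⁻¹ ^ 2)) := by gcongr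
        _ = 2 ^ 2 := by field_simp; norm_num
    · refine le_max_of_le_right ((pi_norm_le_iff_of_nonneg (abs_nonneg c)).2 fun i => ?_)
      exact (he i).trans (le_abs_self c)
  have hd : HasFDerivAt (scaledPsi a f j) (fderiv ℝ (scaledPsi a f j) (ε, ε • m, e))
      (ε, ε • m, e) :=
    (((contDiff_scaledPsi ha hf j).differentiable (by simp)) _).hasFDerivAt
  constructor
  · have h1 : HasFDerivAt (fun m : Fin d → ℝ => (ε, ε • m, e))
        ((0 : (Fin d → ℝ) →L[ℝ] ℝ).prod ((ε • ContinuousLinearMap.id ℝ (Fin d → ℝ)).prod 0)) m :=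
      (hasFDerivAt_const ε m).prodMk
        (((hasFDerivAt_id m).const_smul ε).prodMk (hasFDerivAt_const e m))
    have h2 := ((hasFDerivAt_apply (𝕜 := ℝ) (F' := fun _ : Fin d => ℝ) j m).const_mul 2).add
      (hd.comp m h1)
    have h3 : (fun m => psiFun (rescale a (ε⁻¹ ^ 2)) (rescale f (ε⁻¹ ^ 2)) m e j) =
        (fun m => 2 * m j) + (scaledPsi a f j ∘ fun m => (ε, ε • m, e)) := by
      ext m; exact psiFun_rescale a f ε m e j
    rw [psiDerivM, h3, h2.fderiv]
    -- This scaled direction is the source of the gain 1/√A.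
    have h4 : ((0 : (Fin d → ℝ) →L[ℝ] ℝ).prod ((ε • ContinuousLinearMap.id ℝ (Fin d → ℝ)).prod
        (0 : (Fin d → ℝ) →L[ℝ] (Fin d → ℝ)))) (Pi.single k 1) = ε • v1 k := by
      simp [v1]
    simp only [add_apply, smul_apply, ContinuousLinearMap.comp_apply, h4, map_smul,
      ContinuousLinearMap.proj_apply, Pi.single_apply, smul_eq_mul, mul_ite, mul_one, mul_zero]
    rw [add_sub_cancel_left, abs_mul, abs_of_pos hε, hsq, div_inv_eq_mul, mul_comm]
    refine mul_le_mul_of_nonneg_right ?_ hε.le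
    refine (hK (v1 k) j _ hmem).trans ((le_abs_self _).trans ((hle j k).trans' ?_))
    simp
  · have h1 : HasFDerivAt (fun e : Fin d → ℝ => (ε, ε • m, e))
        ((0 : (Fin d → ℝ) →L[ℝ] ℝ).prod ((0 : (Fin d → ℝ) →L[ℝ] (Fin d → ℝ)).prod
          (ContinuousLinearMap.id ℝ (Fin d → ℝ)))) e :=
      (hasFDerivAt_const ε e).prodMk ((hasFDerivAt_const (ε • m) e).prodMk (hasFDerivAt_id e))
    have h2 := (hd.comp e h1).const_add (2 * m j)
    have h3 : (fun e => psiFun (rescale a (ε⁻¹ ^ 2)) (rescale f (ε⁻¹ ^ 2)) m e j) =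
        fun e => 2 * m j + (scaledPsi a f j ∘ fun e => (ε, ε • m, e)) e := by
      ext e; exact psiFun_rescale a f ε m e j
    rw [psiDerivN, h3, h2.fderiv]
    refine (hK (v2 k) j _ hmem).trans ((le_abs_self _).trans ((hle j k).trans' ?_))
    simp

end Calculus

/-! ### Gradients of moment map components and bounds on a compact Hamiltonian manifold. -/

section Geometry

theorem HermitianStructure.sharp_eq {V : Type*} [AddCommGroup V] [Module ℝ V]
    (S : HermitianStructure V) [FiniteDimensional ℝ V] {f : Module.Dual ℝ V} {u : V}
    (h : ∀ v, S.g u v = f v) : S.sharp f = u := by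
  apply (LinearMap.BilinForm.toDual S.g S.nondegenerate).injective
  ext v
  rw [LinearMap.BilinForm.toDual_def, LinearMap.BilinForm.toDual_def, S.g_sharp, h]

variable {EG : Type*} [NormedAddCommGroup EG] [NormedSpace ℝ EG]
  {G : Type*} [TopologicalSpace G] [ChartedSpace EG G] [Group G]
  {E : Type*} [NormedAddCommGroup E] [NormedSpace ℝ E]
  {M : Type*} [TopologicalSpace M] [ChartedSpace E M] [IsManifold 𝓘(ℝ, E) ∞ M]
  [MulAction G M] {S : AlmostKahler E M} {μ : M → (GroupLieAlgebra 𝓘(ℝ, EG) G →L[ℝ] ℝ)}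

/-- Combined with dμ(K) = ω(K^M, ·), this makes J K^M the gradient of μ(K). -/
theorem AlmostKahler.g_J_left (S : AlmostKahler E M) (x : M) (u v : TangentSpace 𝓘(ℝ, E) x) :
    (S.tangent x).g (S.J x u) v = S.symp x u v := by
  have h : S.symp x (S.J x u) (S.J x (S.J x (-(S.J x v)))) = S.symp x u (S.J x (-(S.J x v))) :=
    (S.tangent x).g_J u (-(S.J x v))
  change S.symp x (S.J x u) (S.J x v) = _
  simpa [S.J_sq] using h

variable {d : ℕ} (V : Module.Basis (Fin d) ℝ (GroupLieAlgebra 𝓘(ℝ, EG) G))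

theorem contMDiff_comps (hμ : IsHamiltonianAction S μ) :
    ContMDiff 𝓘(ℝ, E) 𝓘(ℝ, Fin d → ℝ) ∞ (comps V μ) :=
  contMDiff_pi_space.2 fun i => hμ.smooth_moment (V i)

theorem mfderiv_comps (hμ : IsHamiltonianAction S μ) (x : M) (v : TangentSpace 𝓘(ℝ, E) x)
    (i : Fin d) :
    (mfderiv 𝓘(ℝ, E) 𝓘(ℝ, Fin d → ℝ) (comps V μ) x : E →L[ℝ] (Fin d → ℝ)) v i =
      S.symp x (genField (V i) x) v := by
  rw [← hμ.moment_eq (V i) x v]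
  have h1 : MDifferentiableAt 𝓘(ℝ, E) 𝓘(ℝ, Fin d → ℝ) (comps V μ) x :=
    (contMDiff_comps V hμ).mdifferentiableAt (by simp)
  have h2 : HasMFDerivAt 𝓘(ℝ, Fin d → ℝ) 𝓘(ℝ, ℝ) (fun m : Fin d → ℝ => m i) (comps V μ x)
      (ContinuousLinearMap.proj i) := (hasFDerivAt_apply i (comps V μ x)).hasMFDerivAt
  have h3 := (h2.comp x h1.hasMFDerivAt).mfderiv
  change _ = (mfderiv 𝓘(ℝ, E) 𝓘(ℝ, ℝ) ((fun m : Fin d → ℝ => m i) ∘ comps V μ) x : E →L[ℝ] ℝ) v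
  rw [h3]
  rfl

theorem exists_comps_bound [CompactSpace M] (hμ : IsHamiltonianAction S μ) :
    ∃ C > 0, ∀ y : M, dot (comps V μ y) (comps V μ y) ≤ C := by
  have hcont : Continuous fun y : M => dot (comps V μ y) (comps V μ y) :=
    (contDiff_dot (n := ∞) contDiff_id contDiff_id).continuous.comp
      (contMDiff_comps V hμ).continuous
  obtain ⟨C, hC⟩ := (isCompact_range hcont).bddAbove
  exact ⟨max 1 C, by positivity, fun y => (hC ⟨y, rfl⟩).trans (le_max_right _ _)⟩

/-- The gradient of a function of the components of the moment map. -/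
theorem sharp_mfderiv_comps [FiniteDimensional ℝ E] (hμ : IsHamiltonianAction S μ)
    {F : (Fin d → ℝ) → ℝ} (hF : Differentiable ℝ F) (x : M) :
    (S.tangent x).sharp
        (mfderiv 𝓘(ℝ, E) 𝓘(ℝ, ℝ) (fun z => F (comps V μ z)) x : E →L[ℝ] ℝ).toLinearMap =
      ∑ k, fderiv ℝ F (comps V μ x) (Pi.single k 1) • S.J x (genField (V k) x) := by
  have h1 : MDifferentiableAt 𝓘(ℝ, E) 𝓘(ℝ, Fin d → ℝ) (comps V μ) x :=
    (contMDiff_comps V hμ).mdifferentiableAt (by simp)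
  have h3 := ((hF (comps V μ x)).hasFDerivAt.hasMFDerivAt.comp x h1.hasMFDerivAt).mfderiv
  apply HermitianStructure.sharp_eq
  intro v
  have h4 : (mfderiv 𝓘(ℝ, E) 𝓘(ℝ, ℝ) (fun z => F (comps V μ z)) x : E →L[ℝ] ℝ) v =
      fderiv ℝ F (comps V μ x)
        ((mfderiv 𝓘(ℝ, E) 𝓘(ℝ, Fin d → ℝ) (comps V μ) x : E →L[ℝ] (Fin d → ℝ)) v) :=
    congrArg (fun L : E →L[ℝ] ℝ => L v) h3
  have h5 : ∀ w : Fin d → ℝ, fderiv ℝ F (comps V μ x) w =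
      ∑ k, fderiv ℝ F (comps V μ x) (Pi.single k 1) * w k := fun w => by
    conv_lhs => rw [pi_eq_sum_univ' w]
    simp [mul_comm]
  refine Eq.trans ?_ (h4.trans (h5 _)).symm
  rw [map_sum, LinearMap.sum_apply]
  refine Finset.sum_congr rfl fun k _ => ?_
  rw [map_smul, LinearMap.smul_apply, S.g_J_left, ← mfderiv_comps V hμ, smul_eq_mul]

variable [LieGroup 𝓘(ℝ, EG) ∞ G]

/-- The field is the image, under the tangent map of the action G × M → M, of the smooth section x ↦
(-K, 0) over (1, x). -/
theorem contMDiff_genField (hμ : IsHamiltonianAction S μ) (K : GroupLieAlgebra 𝓘(ℝ, EG) G) :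
    ContMDiff 𝓘(ℝ, E) (𝓘(ℝ, E).prod 𝓘(ℝ, E)) ∞
      (fun x : M => (⟨x, genField K x⟩ : TangentBundle 𝓘(ℝ, E) M)) := by
  let fg : M → TangentBundle 𝓘(ℝ, EG) G := fun _ => ⟨1, -K⟩
  have sfg : ContMDiff 𝓘(ℝ, E) (𝓘(ℝ, EG).prod 𝓘(ℝ, EG)) ∞ fg := contMDiff_const
  let fv : M → TangentBundle 𝓘(ℝ, E) M := fun x => ⟨x, 0⟩
  have sfv : ContMDiff 𝓘(ℝ, E) (𝓘(ℝ, E).prod 𝓘(ℝ, E)) ∞ fv := Bundle.contMDiff_zeroSection _ _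
  have S₂ : ContMDiff _ _ ∞ (equivTangentBundleProd 𝓘(ℝ, EG) G 𝓘(ℝ, E) M).symm :=
    contMDiff_equivTangentBundleProd_symm
  have S₃ : ContMDiff _ _ ∞ (tangentMap (𝓘(ℝ, EG).prod 𝓘(ℝ, E)) 𝓘(ℝ, E)
      (fun p : G × M => p.1 • p.2)) :=
    hμ.smooth_action.contMDiff_tangentMap (m := ∞) (by simp)
  convert! (S₃.comp S₂).comp (sfg.prodMk sfv) with x
  · simp [tangentMap, fg, fv]
  · simp only [Function.comp_apply, tangentMap, fg, fv]
    rw [mfderiv_prod_eq_add_apply (hμ.smooth_action.mdifferentiableAt (by simp))]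
    have h0 : (equivTangentBundleProd 𝓘(ℝ, EG) G 𝓘(ℝ, E) M).symm
      (⟨1, -K⟩, ⟨x, 0⟩) = ⟨(1, x), (-K, 0)⟩ := rfl
    rw [h0]
    change _ = _ + mfderiv _ _ _ x (0 : TangentSpace 𝓘(ℝ, E) x)
    rw [map_zero, add_zero]
    rfl

theorem exists_genField_bound [CompactSpace M] (hμ : IsHamiltonianAction S μ) :
    ∃ C > 0, ∀ (x : M) (j : Fin d),
      (S.tangent x).g (genField (V j) x) (genField (V j) x) ≤ C := by
  have hcont : ∀ j, Continuous fun x : M =>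
      S.symp x (genField (V j) x) (S.J x (genField (V j) x)) := by
    intro j
    have h1 := contMDiff_genField hμ (V j)
    have h2 := S.smooth_J.clm_bundle_apply h1
    have h3 := ContMDiff.clm_bundle_apply₂ (F₃ := ℝ) (E₃ := Bundle.Trivial M ℝ) 
      (ψ := fun x => S.symp x) S.smooth_symp h1 h2
    refine continuous_iff_continuousAt.2 fun x => ?_
    have h4 := (Bundle.contMDiffAt_totalSpace.1 (h3 x)).2.continuousAt
    simpa using h4
  have hb : ∀ j, ∃ C, ∀ x : M, S.symp x (genField (V j) x) (S.J x (genField (V j) x)) ≤ C := by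
    intro j
    obtain ⟨C, hC⟩ := (isCompact_range (hcont j)).bddAbove
    exact ⟨C, fun x => hC ⟨x, rfl⟩⟩
  choose C hC using hb
  refine ⟨1 + ∑ j, |C j|, by positivity, fun x j => (hC j x).trans ?_⟩
  have := Finset.single_le_sum (f := fun j => |C j|) (fun j _ => abs_nonneg _) (Finset.mem_univ j)
  have := le_abs_self (C j)
  linarith

end Geometry

/-! ### Completing the square for quadratic operators. -/

section Operators

open scoped InnerProductSpace

/-- The quadratic operator `∑ P_jk a_k^* a_j + ∑ (a_k^* B_k + B_k^* a_k)`, where `a'` and `B'` stand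
for the adjoints of `a` and `B`. -/
noncomputable def quadOp {H : Type*} [AddCommGroup H] [Module ℂ H] {d : ℕ}
    (P : Fin d → Fin d → ℝ) (a a' B B' : Fin d → Module.End ℂ H) : Module.End ℂ H :=
  ∑ k, (∑ j, (P j k : ℂ) • (a' k * a j) + (a' k * B k + B' k * a k))

variable {H : Type*} [NormedAddCommGroup H] [InnerProductSpace ℂ H] {d : ℕ}
  {a a' B B' : Fin d → Module.End ℂ H}

theorem inner_quadOp_left (ha : ∀ k σ τ, ⟪a' k σ, τ⟫_ℂ = ⟪σ, a k τ⟫_ℂ)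
    (hB : ∀ k σ τ, ⟪B' k σ, τ⟫_ℂ = ⟪σ, B k τ⟫_ℂ) (P : Fin d → Fin d → ℝ) (σ τ : H) :
    ⟪quadOp P a a' B B' σ, τ⟫_ℂ =
      ∑ k, (∑ j, (P j k : ℂ) * ⟪a j σ, a k τ⟫_ℂ + (⟪B k σ, a k τ⟫_ℂ + ⟪a k σ, B k τ⟫_ℂ)) := by
  simp [quadOp, ha, hB]

theorem inner_quadOp_right (ha : ∀ k σ τ, ⟪a' k σ, τ⟫_ℂ = ⟪σ, a k τ⟫_ℂ)
    (hB : ∀ k σ τ, ⟪B' k σ, τ⟫_ℂ = ⟪σ, B k τ⟫_ℂ) (P : Fin d → Fin d → ℝ) (σ τ : H) :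
    ⟪σ, quadOp P a a' B B' τ⟫_ℂ =
      ∑ k, (∑ j, (P j k : ℂ) * ⟪a k σ, a j τ⟫_ℂ + (⟪a k σ, B k τ⟫_ℂ + ⟪B k σ, a k τ⟫_ℂ)) := by
  have ha' : ∀ k σ τ, ⟪σ, a' k τ⟫_ℂ = ⟪a k σ, τ⟫_ℂ := fun k σ τ => by
    rw [← inner_conj_symm, ha, inner_conj_symm]
  have hB' : ∀ k σ τ, ⟪σ, B' k τ⟫_ℂ = ⟪B k σ, τ⟫_ℂ := fun k σ τ => by
    rw [← inner_conj_symm, hB, inner_conj_symm]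
  simp [quadOp, ha', hB']

theorem quadOp_symmetric (ha : ∀ k σ τ, ⟪a' k σ, τ⟫_ℂ = ⟪σ, a k τ⟫_ℂ)
    (hB : ∀ k σ τ, ⟪B' k σ, τ⟫_ℂ = ⟪σ, B k τ⟫_ℂ) {P : Fin d → Fin d → ℝ}
    (hP : ∀ j k, P j k = P k j) (σ τ : H) :
    ⟪quadOp P a a' B B' σ, τ⟫_ℂ = ⟪σ, quadOp P a a' B B' τ⟫_ℂ := by
  rw [inner_quadOp_left ha hB, inner_quadOp_right ha hB]
  simp only [Finset.sum_add_distrib]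
  refine congrArg₂ (· + ·) (Finset.sum_comm.trans ?_) (add_comm _ _)
  exact Finset.sum_congr rfl fun k _ => Finset.sum_congr rfl fun j _ => by rw [hP]

/-- The P-part is at least (2 - δ d) Σ |a_k σ|² ≥ Σ |a_k σ|². The cross terms satisfy 2 Re⟨a_k σ,
B_k σ⟩ ≥ -|a_k σ|² - |B_k σ|², so the unbounded a_k drop out and each k costs at most β² |σ|². -/
theorem quadOp_ge (ha : ∀ k σ τ, ⟪a' k σ, τ⟫_ℂ = ⟪σ, a k τ⟫_ℂ)
    (hB : ∀ k σ τ, ⟪B' k σ, τ⟫_ℂ = ⟪σ, B k τ⟫_ℂ) {P : Fin d → Fin d → ℝ} {δ β : ℝ}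
    (hP : ∀ j k, |P j k - if j = k then 2 else 0| ≤ δ) (hδ : δ * d ≤ 1)
    (hβ : ∀ k σ, ‖B k σ‖ ≤ β * ‖σ‖) (σ : H) :
    -(d * β ^ 2) * ‖σ‖ ^ 2 ≤ (⟪σ, quadOp P a a' B B' σ⟫_ℂ).re := by
  have hcross : ∀ k, -‖a k σ‖ ^ 2 - β ^ 2 * ‖σ‖ ^ 2 ≤
      (⟪a k σ, B k σ⟫_ℂ + ⟪B k σ, a k σ⟫_ℂ).re := fun k => by
    have h1 : (⟪B k σ, a k σ⟫_ℂ).re = (⟪a k σ, B k σ⟫_ℂ).re := by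
      rw [← inner_conj_symm, Complex.conj_re]
    have h2 : |(⟪a k σ, B k σ⟫_ℂ).re| ≤ ‖a k σ‖ * ‖B k σ‖ :=
      (Complex.abs_re_le_norm _).trans (norm_inner_le_norm _ _)
    have h3 := neg_abs_le (⟪a k σ, B k σ⟫_ℂ).re
    have h4 : ‖B k σ‖ ^ 2 ≤ (β * ‖σ‖) ^ 2 := pow_le_pow_left₀ (norm_nonneg _) (hβ k σ) 2
    rw [Complex.add_re, h1]
    nlinarith [sq_nonneg (‖a k σ‖ - ‖B k σ‖)]
  -- The deviation of P from 2 Id is estimated entrywise by Cauchy–Schwarz and the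
  -- arithmetic-geometric mean inequality.
  have hterm : ∀ k j, (if j = k then 2 * ‖a k σ‖ ^ 2 else 0) -
      δ * ((‖a k σ‖ ^ 2 + ‖a j σ‖ ^ 2) / 2) ≤ ((P j k : ℂ) * ⟪a k σ, a j σ⟫_ℂ).re := fun k j => by
    have h2 : |(⟪a k σ, a j σ⟫_ℂ).re| ≤ ‖a k σ‖ * ‖a j σ‖ :=
      (Complex.abs_re_le_norm _).trans (norm_inner_le_norm _ _)
    have h3 : ‖a k σ‖ * ‖a j σ‖ ≤ (‖a k σ‖ ^ 2 + ‖a j σ‖ ^ 2) / 2 := by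
      nlinarith [sq_nonneg (‖a k σ‖ - ‖a j σ‖)]
    have h4 := neg_abs_le ((P j k - if j = k then 2 else 0) * (⟪a k σ, a j σ⟫_ℂ).re)
    rw [abs_mul] at h4
    have h5 := mul_le_mul (hP j k) (h2.trans h3) (abs_nonneg _) ((abs_nonneg _).trans (hP j k))
    rw [Complex.re_ofReal_mul]
    split_ifs with h
    · subst h
      have h6 : (⟪a j σ, a j σ⟫_ℂ).re = ‖a j σ‖ ^ 2 := (norm_sq_eq_re_inner (𝕜 := ℂ) _).symm
      simp only [if_true] at h4 h5
      nlinarith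
    · simp only [if_neg h, sub_zero] at h4 h5
      linarith
  have hsum : ∑ k, ∑ j, ((if j = k then 2 * ‖a k σ‖ ^ 2 else 0) -
      δ * ((‖a k σ‖ ^ 2 + ‖a j σ‖ ^ 2) / 2)) = (2 - δ * d) * ∑ k, ‖a k σ‖ ^ 2 := by
    simp only [Finset.sum_sub_distrib, Finset.sum_ite_eq', Finset.mem_univ, if_true,
      ← Finset.mul_sum, ← Finset.sum_div, Finset.sum_add_distrib, Finset.sum_const,
      Finset.card_univ, Fintype.card_fin, nsmul_eq_mul]
    ring
  rw [inner_quadOp_right ha hB, Complex.re_sum]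
  have hle : ∑ k, (∑ j, ((if j = k then 2 * ‖a k σ‖ ^ 2 else 0) -
      δ * ((‖a k σ‖ ^ 2 + ‖a j σ‖ ^ 2) / 2)) + (-‖a k σ‖ ^ 2 - β ^ 2 * ‖σ‖ ^ 2)) ≤
      ∑ k, (∑ j, (P j k : ℂ) * ⟪a k σ, a j σ⟫_ℂ + (⟪a k σ, B k σ⟫_ℂ + ⟪B k σ, a k σ⟫_ℂ)).re := by
    refine Finset.sum_le_sum fun k _ => ?_
    rw [Complex.add_re, Complex.re_sum]
    exact add_le_add (Finset.sum_le_sum fun j _ => hterm k j) (hcross k)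
  refine le_trans ?_ hle
  rw [Finset.sum_add_distrib, hsum, Finset.sum_sub_distrib]
  simp only [Finset.sum_neg_distrib, Finset.sum_const, Finset.card_univ, Fintype.card_fin,
    nsmul_eq_mul]
  have : 0 ≤ (1 - δ * d) * ∑ k, ‖a k σ‖ ^ 2 :=
    mul_nonneg (by linarith) (Finset.sum_nonneg fun _ _ => by positivity)
  nlinarith

end Operators

/-! ### Clifford products in terms of creation and annihilation operators. -/

namespace HermitianStructure

variable {V : Type*} [AddCommGroup V] [Module ℝ V] (S : HermitianStructure V)

theorem cliff_J_mul_cliff (u v : V) :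
    Complex.I • (S.cliff (S.J v) * S.cliff u) =
      (-2 : ℂ) • ((S.wedge v + S.contract v) * (S.wedge u - S.contract u)) := by
  have h2 : ((Real.sqrt 2 : ℝ) : ℂ) * ((Real.sqrt 2 : ℝ) : ℂ) = 2 := by
    rw [← Complex.ofReal_mul, Real.mul_self_sqrt (by norm_num)]; norm_num
  rw [cliff_J, cliff_eq, smul_mul_assoc, smul_mul_assoc, mul_smul_comm, smul_smul, smul_smul,
    smul_smul]
  congr 1
  linear_combination (Complex.I * Complex.I) * h2 + 2 * Complex.I_mul_I

/-- The antisymmetric part of `√-1 c(J v) c(u) / 4`. -/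
noncomputable def skewPart (u v : V) : Module.End ℂ S.Spinor :=
  (1 / 2 : ℂ) • (S.wedge u * S.contract v - S.wedge v * S.contract u +
    S.contract v * S.contract u - S.wedge v * S.wedge u)

theorem skewPart_swap (u v : V) : S.skewPart v u = -S.skewPart u v := by
  rw [skewPart, skewPart, S.contract_mul_contract u v, S.wedge_mul_wedge u v]
  module

/-- Normal ordering `contract v * wedge u` leaves the constant -(g(u, v) + √-1 g(u, J v)) / 4, which
the scalar from I₂ cancels exactly. -/
theorem cliff_J_mul_cliff_add (u v : V) :
    Complex.I • ((1 / 4 : ℂ) • (S.cliff (S.J v) * S.cliff u)) +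
      (Complex.I * ((1 / 4 : ℂ) * ((S.g u (S.J v) : ℝ) + (S.g (S.J u) (S.J v) : ℝ) / Complex.I))) •
        (1 : Module.End ℂ S.Spinor) = S.wedge v * S.contract u + S.skewPart u v := by
  rw [smul_comm, cliff_J_mul_cliff, skewPart, mul_sub, add_mul, add_mul, S.contract_mul_wedge v u,
    eval01_dual01, S.J_skew u v, S.g_J]
  have hI : Complex.I * (1 / 4 * ((S.g u (S.J v) : ℝ) + (S.g u v : ℝ) / Complex.I)) =
      (1 / 4 : ℂ) * (Complex.I * (S.g u (S.J v) : ℝ) + (S.g u v : ℝ)) := by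
    field_simp
  rw [hI]
  push_cast
  module

theorem wedge_contract_anticomm {u v : V} (h : S.g u v = 0) (h' : S.g (S.J u) v = 0) :
    S.contract v * S.wedge u = -(S.wedge u * S.contract v) := by
  rw [contract_mul_wedge, eval01_dual01, h, h']
  simp

/-- For complex-orthogonal u and w all the operators anticommute without a constant, so `wedge u`
can be moved to the left and `contract u` to the right. For real p and q the two resulting terms are
adjoint to each other. -/
theorem cross_terms {u w : V} (h : S.g u w = 0) (h' : S.g (S.J u) w = 0) (p q : ℂ) :
    p • ((1 / 2 : ℂ) • (Complex.I • (S.cliff (S.J u) * S.cliff w))) +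
        q • ((1 / 2 : ℂ) • (Complex.I • (S.cliff (S.J w) * S.cliff u))) =
      S.wedge u * ((p + q) • S.contract w + (q - p) • S.wedge w) +
        ((p + q) • S.wedge w + (q - p) • S.contract w) * S.contract u := by
  have h1 : S.contract w * S.wedge u = -(S.wedge u * S.contract w) := S.wedge_contract_anticomm h h'
  have h2 : S.contract u * S.wedge w = -(S.wedge w * S.contract u) := by
    refine S.wedge_contract_anticomm (by rw [S.symm, h]) ?_
    rw [S.J_skew, S.symm, h', neg_zero]
  rw [cliff_J_mul_cliff, cliff_J_mul_cliff]
  simp only [mul_sub, add_mul, mul_add, smul_mul_assoc, mul_smul_comm, h1, h2,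
    S.wedge_mul_wedge w u, S.contract_mul_contract u w]
  module

theorem cliff_sum_smul {κ : Type*} (s : Finset κ) (p : κ → ℝ) (v : κ → V) :
    S.cliff (∑ k ∈ s, p k • v k) = ∑ k ∈ s, (p k : ℂ) • S.cliff (v k) := by
  classical
  induction s using Finset.induction_on with
  | empty => simpa using S.cliff_smul 0 0
  | insert k s hk ih => rw [Finset.sum_insert hk, Finset.sum_insert hk, cliff_add, cliff_smul, ih]

variable [FiniteDimensional ℝ V]

theorem spinorInner_contract (v : V) (σ τ : S.Spinor) :
    S.spinorInner (S.contract v σ) τ = S.spinorInner σ (S.wedge v τ) := by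
  rw [← spinorInner_conj, ← spinorInner_wedge, spinorInner_conj]

/-- The anticommutator of the mutually adjoint operators `wedge v` and `contract v` is g(v, v) / 2.
Hence both are bounded in terms of the length of v. -/
theorem spinorInner_contract_add_wedge (v : V) (σ : S.Spinor) :
    (S.spinorInner (S.contract v σ) (S.contract v σ)).re +
      (S.spinorInner (S.wedge v σ) (S.wedge v σ)).re =
      S.g v v / 2 * (S.spinorInner σ σ).re := by
  rw [spinorInner_wedge, spinorInner_contract, ← Complex.add_re, ← spinorInner_add_right]
  have h : S.wedge v (S.contract v σ) + S.contract v (S.wedge v σ) =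
      ((S.g v v / 2 : ℝ) : ℂ) • σ := by
    have h1 := LinearMap.congr_fun (S.contract_mul_wedge v v) σ
    have h0 : S.g (S.J v) v = 0 := by
      have := S.J_skew v v
      rw [S.symm v] at this
      linarith
    simp only [Module.End.mul_apply, LinearMap.sub_apply, LinearMap.smul_apply,
      Module.End.one_apply, eval01_dual01, h0] at h1
    rw [h1, add_sub_cancel]
    simp
  rw [h, spinorInner_smul_right, Complex.re_ofReal_mul]

end HermitianStructure

/-! ### The operator on a product as a quadratic operator. -/

namespace HermitianStructure

section Product

variable {V W : Type*} [AddCommGroup V] [Module ℝ V] [AddCommGroup W] [Module ℝ W]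
  (S : HermitianStructure V) (S' : HermitianStructure W) {d : ℕ}
  (P Q : Fin d → Fin d → ℝ) (u : Fin d → V) (w : Fin d → W)

/-- The operator `√-1 (I₁ + I₂)` formed from vectors `u_j`, `w_j` and the matrices `P`, `Q` of the
partial derivatives of the coefficients. -/
noncomputable def cliffOp : Module.End ℂ (S.prod S').Spinor :=
  Complex.I • (∑ j, ((1 / 4 : ℂ) • ((S.prod S').cliff (∑ k, P j k • S.J (u k), 0) *
        (S.prod S').cliff (u j, (2 : ℝ) • w j)) +
      (1 / 2 : ℂ) • ((S.prod S').cliff (0, ∑ k, Q j k • S'.J (w k)) *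
        (S.prod S').cliff (u j, 0))) +
    (∑ j, (1 / 4 : ℂ) * ((S.g (u j) (∑ k, P j k • S.J (u k)) : ℝ) +
      (S.g (S.J (u j)) (∑ k, P j k • S.J (u k)) : ℝ) / Complex.I)) • 1)

/-- The coefficient of `a_k^*` in the cross terms of `cliffOp`. -/
noncomputable def crossOp (k : Fin d) : Module.End ℂ (S.prod S').Spinor :=
  ∑ j, (((P j k + Q k j : ℝ) : ℂ) • (S.prod S').contract (0, w j) +
    ((Q k j - P j k : ℝ) : ℂ) • (S.prod S').wedge (0, w j))

/-- The adjoint of `crossOp`. -/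
noncomputable def crossOpAdj (k : Fin d) : Module.End ℂ (S.prod S').Spinor :=
  ∑ j, (((P j k + Q k j : ℝ) : ℂ) • (S.prod S').wedge (0, w j) +
    ((Q k j - P j k : ℝ) : ℂ) • (S.prod S').contract (0, w j))

theorem prod_g (x y : V × W) : (S.prod S').g x y = S.g x.1 y.1 + S'.g x.2 y.2 := rfl

theorem prod_J (x : V × W) : (S.prod S').J x = (S.J x.1, S'.J x.2) := rfl

theorem cliffOp_eq_quadOp (hP : ∀ j k, P j k = P k j) :
    cliffOp S S' P Q u w = quadOp P (fun j => (S.prod S').contract (u j, 0))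
      (fun j => (S.prod S').wedge (u j, 0)) (crossOp S S' P Q w) (crossOpAdj S S' P Q w) := by
  have h1 : ∀ j, (S.prod S').cliff (∑ k, P j k • S.J (u k), 0) =
      ∑ k, (P j k : ℂ) • (S.prod S').cliff ((S.prod S').J (u k, 0)) := fun j => by
    rw [← cliff_sum_smul]
    congr 1
    ext <;> simp [prod_J, Prod.fst_sum, Prod.snd_sum]
  have h2 : ∀ j, (S.prod S').cliff (0, ∑ k, Q j k • S'.J (w k)) =
      ∑ k, (Q j k : ℂ) • (S.prod S').cliff ((S.prod S').J (0, w k)) := fun j => by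
    rw [← cliff_sum_smul]
    congr 1
    ext <;> simp [prod_J, Prod.fst_sum, Prod.snd_sum]
  have h3 : ∀ j, (S.prod S').cliff (u j, (2 : ℝ) • w j) =
      (S.prod S').cliff (u j, 0) + (2 : ℂ) • (S.prod S').cliff (0, w j) := fun j => by
    have := (S.prod S').cliff_smul 2 (0, w j)
    rw [Complex.ofReal_ofNat] at this
    rw [← this, ← cliff_add]
    simp
  let z : Fin d → Fin d → Module.End ℂ (S.prod S').Spinor :=
    fun j k => (S.prod S').skewPart (u j, 0) (u k, 0)
  -- A symmetric matrix paired with an antisymmetric family; this is where the symmetry of P is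
  -- needed for the identity.
  have hz : ∑ j, ∑ k, (P j k : ℂ) • z j k = 0 := by
    have h : ∑ j, ∑ k, (P j k : ℂ) • z j k = -∑ j, ∑ k, (P j k : ℂ) • z j k := by
      conv_lhs => rw [Finset.sum_comm]
      rw [← Finset.sum_neg_distrib]
      refine Finset.sum_congr rfl fun j _ => ?_
      rw [← Finset.sum_neg_distrib]
      refine Finset.sum_congr rfl fun k _ => ?_
      rw [hP k j]
      refine Eq.trans ?_ (smul_neg _ _)
      exact congrArg _ ((S.prod S').skewPart_swap _ _)
    have h' := add_eq_zero_iff_eq_neg.2 h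
    rw [← two_smul ℂ] at h'
    exact (smul_eq_zero_iff_right two_ne_zero).1 h'
  have h4 : ∀ j k, (P j k : ℂ) • (Complex.I • ((1 / 4 : ℂ) •
      ((S.prod S').cliff ((S.prod S').J (u k, 0)) *
        (S.prod S').cliff (u j, 0))) + (Complex.I * ((1 / 4 : ℂ) * ((S.g (u j) (S.J (u k)) : ℝ) +
          (S.g (S.J (u j)) (S.J (u k)) : ℝ) / Complex.I))) • (1 : Module.End ℂ (S.prod S').Spinor)) =
      (P j k : ℂ) • ((S.prod S').wedge (u k, 0) * (S.prod S').contract (u j, 0)) +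
        (P j k : ℂ) • z j k := by
    intro j k
    rw [← smul_add, ← (S.prod S').cliff_J_mul_cliff_add]
    simp [prod_J, prod_g]
  have h5 : ∀ j k, (P j k : ℂ) • ((1 / 2 : ℂ) • (Complex.I •
      ((S.prod S').cliff ((S.prod S').J (u k, 0)) *
        (S.prod S').cliff (0, w j)))) + (Q k j : ℂ) • ((1 / 2 : ℂ) • (Complex.I •
          ((S.prod S').cliff ((S.prod S').J (0, w j)) *
        (S.prod S').cliff (u k, 0)))) = _ := fun j k =>
    (S.prod S').cross_terms (by simp [prod_g]) (by simp [prod_g, prod_J]) _ _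
  have h6 : cliffOp S S' P Q u w = ∑ j, ∑ k, (P j k : ℂ) • (Complex.I • ((1 / 4 : ℂ) •
        ((S.prod S').cliff ((S.prod S').J (u k, 0)) * (S.prod S').cliff (u j, 0))) +
          (Complex.I * ((1 / 4 : ℂ) * ((S.g (u j) (S.J (u k)) : ℝ) +
          (S.g (S.J (u j)) (S.J (u k)) : ℝ) / Complex.I))) • (1 : Module.End ℂ (S.prod S').Spinor)) +
      (∑ j, ∑ k, (P j k : ℂ) • ((1 / 2 : ℂ) • (Complex.I •
        ((S.prod S').cliff ((S.prod S').J (u k, 0)) *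
        (S.prod S').cliff (0, w j)))) + ∑ j, ∑ k, (Q j k : ℂ) • ((1 / 2 : ℂ) • (Complex.I •
          ((S.prod S').cliff ((S.prod S').J (0, w k)) * (S.prod S').cliff (u j, 0))))) := by
    rw [cliffOp]
    simp only [h1, h2, h3, Finset.smul_sum, Finset.sum_smul, smul_add, map_sum, map_smul]
    simp only [← Finset.sum_add_distrib]
    refine Finset.sum_congr rfl fun j _ => ?_
    push_cast
    simp only [Finset.sum_mul, Finset.mul_sum, Finset.sum_div, Finset.smul_sum, Finset.sum_smul,
      ← Finset.sum_add_distrib]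
    refine Finset.sum_congr rfl fun k _ => ?_
    simp only [smul_mul_assoc, mul_smul_comm, mul_add, smul_eq_mul]
    push_cast
    module
  -- Exchanging the indices in the Q-sum pairs c(J w_j) c(u_k) with c(J u_k) c(w_j), as
  -- `cross_terms` requires.
  rw [h6, Finset.sum_comm (f := fun j k => (Q j k : ℂ) • _)]
  simp only [← Finset.sum_add_distrib, h4, h5]
  simp only [Finset.sum_add_distrib, hz, add_zero]
  rw [quadOp, Finset.sum_add_distrib]
  refine congrArg₂ (· + ·) Finset.sum_comm ?_
  simp only [← Finset.sum_add_distrib]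
  rw [Finset.sum_comm]
  refine Finset.sum_congr rfl fun k _ => ?_
  simp only [crossOp, crossOpAdj, Finset.mul_sum, Finset.sum_mul, ← Finset.sum_add_distrib]
  push_cast
  rfl

variable [FiniteDimensional ℝ V] [FiniteDimensional ℝ W]

/-- The bound does not involve the vectors `u`, which are the possibly unbounded V_j^M. In it, `d *
(4 * K * c)` bounds each B_k: there are d summands, each with two coefficients at most 2K and two
operators of norm at most c. -/
theorem cliffOp_geSmulId {P Q : Fin d → Fin d → ℝ} (hP : ∀ j k, P j k = P k j) {w : Fin d → W}
    {δ K c : ℝ} (hδ : ∀ j k, |P j k - if j = k then 2 else 0| ≤ δ) (hδd : δ * d ≤ 1)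
    (hPK : ∀ j k, |P j k| ≤ K) (hQK : ∀ j k, |Q j k| ≤ K) (hc : 0 ≤ c)
    (hw : ∀ j, S'.g (w j) (w j) ≤ c ^ 2) :
    (S.prod S').GeSmulId (cliffOp S S' P Q u w) (-(d * (d * (4 * K * c)) ^ 2)) := by
  set R := S.prod S' with hR
  let _ : NormedAddCommGroup R.Spinor := R.spinorCore.toNormedAddCommGroup
  let _ : InnerProductSpace ℂ R.Spinor := InnerProductSpace.ofCore R.spinorCore.toCore
  have hinner : ∀ σ τ : R.Spinor, R.spinorInner σ τ = inner ℂ σ τ := fun _ _ => rfl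
  have hnorm : ∀ σ : R.Spinor, (R.spinorInner σ σ).re = ‖σ‖ ^ 2 := fun σ =>
    (norm_sq_eq_re_inner (𝕜 := ℂ) σ).symm
  have ha : ∀ k (σ τ : R.Spinor), inner ℂ (R.wedge (u k, 0) σ) τ =
      inner ℂ σ (R.contract (u k, 0) τ) := fun k σ τ => R.spinorInner_wedge _ σ τ
  have hB : ∀ k (σ τ : R.Spinor), inner ℂ (crossOpAdj S S' P Q w k σ) τ =
      inner ℂ σ (crossOp S S' P Q w k τ) := fun k σ τ => by
    simp only [crossOp, crossOpAdj, LinearMap.sum_apply, LinearMap.add_apply,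
      LinearMap.smul_apply, sum_inner, inner_sum, inner_add_left, inner_add_right,
      inner_smul_left, inner_smul_right, Complex.conj_ofReal]
    refine Finset.sum_congr rfl fun j _ => ?_
    exact congrArg₂ (· + ·) (congrArg _ (R.spinorInner_wedge _ σ τ))
      (congrArg _ (R.spinorInner_contract _ σ τ))
  have hbound : ∀ j (σ : R.Spinor), ‖R.contract (0, w j) σ‖ ≤ c * ‖σ‖ ∧
      ‖R.wedge (0, w j) σ‖ ≤ c * ‖σ‖ := fun j σ => by
    have h := R.spinorInner_contract_add_wedge (0, w j) σ
    rw [hnorm, hnorm, hnorm] at h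
    have h1 : R.g (0, w j) (0, w j) ≤ c ^ 2 := by simpa [hR, prod_g] using hw j
    have h2 : R.g (0, w j) (0, w j) / 2 * ‖σ‖ ^ 2 ≤ (c * ‖σ‖) ^ 2 := by
      rw [mul_pow]
      refine mul_le_mul_of_nonneg_right ?_ (sq_nonneg _)
      nlinarith [sq_nonneg c]
    have h3 : 0 ≤ c * ‖σ‖ := mul_nonneg hc (norm_nonneg _)
    constructor <;> refine le_of_sq_le_sq ?_ h3 <;>
      nlinarith [sq_nonneg ‖R.contract (0, w j) σ‖, sq_nonneg ‖R.wedge (0, w j) σ‖]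
  have hβ : ∀ k (σ : R.Spinor), ‖crossOp S S' P Q w k σ‖ ≤ d * (4 * K * c) * ‖σ‖ := by
    intro k σ
    simp only [crossOp, LinearMap.sum_apply]
    refine (norm_sum_le _ _).trans ?_
    have hterm : ∀ j ∈ Finset.univ, ‖((((P j k + Q k j : ℝ) : ℂ) • R.contract (0, w j) +
        ((Q k j - P j k : ℝ) : ℂ) • R.wedge (0, w j)) : Module.End ℂ R.Spinor) σ‖ ≤
        4 * K * c * ‖σ‖ := fun j _ => by
      have hp : |P j k + Q k j| ≤ 2 * K := (abs_add_le _ _).trans (by linarith [hPK j k, hQK k j])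
      have hq : |Q k j - P j k| ≤ 2 * K := (abs_sub _ _).trans (by linarith [hPK j k, hQK k j])
      rw [LinearMap.add_apply, LinearMap.smul_apply, LinearMap.smul_apply]
      refine (norm_add_le _ _).trans ?_
      rw [norm_smul, norm_smul, Complex.norm_real, Complex.norm_real, Real.norm_eq_abs,
        Real.norm_eq_abs]
      have h1 := mul_le_mul hp (hbound j σ).1 (norm_nonneg _) ((abs_nonneg _).trans hp)
      have h2 := mul_le_mul hq (hbound j σ).2 (norm_nonneg _) ((abs_nonneg _).trans hq)
      linarith
    refine (Finset.sum_le_sum hterm).trans (le_of_eq ?_)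
    rw [Finset.sum_const, Finset.card_univ, Fintype.card_fin, nsmul_eq_mul]
    ring
  rw [cliffOp_eq_quadOp S S' P Q u w hP]
  refine ⟨fun σ τ => quadOp_symmetric ha hB hP σ τ, fun σ => ?_⟩
  rw [hnorm]
  exact quadOp_ge ha hB hδ hδd hβ σ

end Product

end HermitianStructure

/-! ### Assembly of the estimates. -/

section Main

variable {EG : Type*} [NormedAddCommGroup EG] [NormedSpace ℝ EG]
  {G : Type*} [TopologicalSpace G] [ChartedSpace EG G] [Group G]
  {EM : Type*} [NormedAddCommGroup EM] [NormedSpace ℝ EM] [FiniteDimensional ℝ EM]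
  {M : Type*} [TopologicalSpace M] [ChartedSpace EM M] [IsManifold 𝓘(ℝ, EM) ∞ M]
  [MulAction G M]
  {EN : Type*} [NormedAddCommGroup EN] [NormedSpace ℝ EN] [FiniteDimensional ℝ EN]
  {N : Type*} [TopologicalSpace N] [ChartedSpace EN N] [IsManifold 𝓘(ℝ, EN) ∞ N]
  [MulAction G N]
  {d : ℕ} (V : Module.Basis (Fin d) ℝ (GroupLieAlgebra 𝓘(ℝ, EG) G))
  {SM : AlmostKahler EM M} {SN : AlmostKahler EN N}
  {μ : M → (GroupLieAlgebra 𝓘(ℝ, EG) G →L[ℝ] ℝ)} {η : N → (GroupLieAlgebra 𝓘(ℝ, EG) G →L[ℝ] ℝ)}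

theorem opI12_eq_cliffOp (hμ : IsHamiltonianAction SM μ) (hη : IsHamiltonianAction SN η)
    {α φ : ℝ → ℝ} (hα : ContDiff ℝ ∞ α) (hφ : ContDiff ℝ ∞ φ) (x : M) (y : N) :
    opI12 V μ η α φ SM SN x y = (SM.tangent x).cliffOp (SN.tangent y)
      (psiDerivM α φ (comps V μ x) (comps V η y)) (psiDerivN α φ (comps V μ x) (comps V η y))
      (fun j => genField (V j) x) (fun j => genField (V j) y) := by
  have h1 : ∀ j, gradM V μ η α φ SM j x y =
      ∑ k, psiDerivM α φ (comps V μ x) (comps V η y) j k • SM.J x (genField (V k) x) := fun j =>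
    sharp_mfderiv_comps V hμ (differentiable_psiFun_left hα hφ (comps V η y) j) x
  have h2 : ∀ j, gradN V μ η α φ SN j x y =
      ∑ k, psiDerivN α φ (comps V μ x) (comps V η y) j k • SN.J y (genField (V k) y) := fun j =>
    sharp_mfderiv_comps V hη (differentiable_psiFun_right hα hφ (comps V μ x) j) y
  simp only [opI12, opI1, scalarI2, h1, h2]
  rfl

/-- Expanding |m + 3e|² ≥ 0 gives 2⟨m, e⟩ ≥ -|m|²/3 - 3|e|², hence |m|² ≤ 3A + 3|e|² ≤ 4A. -/
theorem dot_le_of_dot_add_le {m e : Fin d → ℝ} {A : ℝ} (h : dot (m + e) (m + e) ≤ 2 * A)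
    (he : 3 * dot e e ≤ A) : dot m m ≤ 4 * A := by
  have h0 : 0 ≤ dot (m + (3 : ℝ) • e) (m + (3 : ℝ) • e) :=
    Finset.sum_nonneg fun i _ => mul_self_nonneg _
  simp only [dot_add_left, dot_add_right, dot_smul_left, dot_smul_right, dot_comm e m] at h h0
  linarith

end Main

end MomentMapDeformation

open MomentMapDeformation in
theorem mainTheorem11
    {EG : Type*} [NormedAddCommGroup EG] [NormedSpace ℝ EG] [FiniteDimensional ℝ EG]
    {G : Type*} [TopologicalSpace G] [ChartedSpace EG G] [Group G] [LieGroup 𝓘(ℝ, EG) ∞ G]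
    [T2Space G] [CompactSpace G] [ConnectedSpace G]
    {EM : Type*} [NormedAddCommGroup EM] [NormedSpace ℝ EM] [FiniteDimensional ℝ EM]
    {M : Type*} [TopologicalSpace M] [ChartedSpace EM M] [IsManifold 𝓘(ℝ, EM) ∞ M]
    [T2Space M] [SecondCountableTopology M] [MulAction G M]
    {EN : Type*} [NormedAddCommGroup EN] [NormedSpace ℝ EN] [FiniteDimensional ℝ EN]
    {N : Type*} [TopologicalSpace N] [ChartedSpace EN N] [IsManifold 𝓘(ℝ, EN) ∞ N]
    [T2Space N] [CompactSpace N] [MulAction G N]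
    (SM : AlmostKahler EM M) (SN : AlmostKahler EN N)
    (μ : M → (GroupLieAlgebra 𝓘(ℝ, EG) G →L[ℝ] ℝ)) (η : N → (GroupLieAlgebra 𝓘(ℝ, EG) G →L[ℝ] ℝ))
    (hμ : IsHamiltonianAction SM μ) (hη : IsHamiltonianAction SN η)
    (hproper : ∀ K : Set (GroupLieAlgebra 𝓘(ℝ, EG) G →L[ℝ] ℝ), IsCompact K → IsCompact (μ ⁻¹' K))
    (ip : LinearMap.BilinForm ℝ (GroupLieAlgebra 𝓘(ℝ, EG) G)) (hip : IsAdInvariantInner ip)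
    {d : ℕ} (V : Module.Basis (Fin d) ℝ (GroupLieAlgebra 𝓘(ℝ, EG) G))
    (hV : ∀ i j, ip (V i) (V j) = if i = j then 1 else 0)
    (a f : ℝ → ℝ) (haf : IsCutoffPair a f) :
    ∃ C > 0, ∃ A₀ > 0, ∀ A > A₀, ∀ (x : M) (y : N), (x, y) ∈ region V μ η A →
      fieldX (EM := EM) (EN := EN) V μ η (rescale a A) (rescale f A) x y = 0 →
      (prodStr SM SN x y).GeSmulId (opI12 V μ η (rescale a A) (rescale f A) SM SN x y) (-C) := by
  obtain ⟨Cη, hCη, hη_le⟩ := exists_comps_bound V hη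
  obtain ⟨Cg, hCg, hg_le⟩ := exists_genField_bound V hη
  obtain ⟨K, hK, hK_le⟩ := exists_psiDeriv_bound (d := d) haf.smooth_a haf.smooth_f (√Cη)
  have hb : 0 ≤ d * (d * (4 * (K + 2) * √Cg)) ^ 2 := by positivity
  -- The summand 1 keeps C positive even for d = 0. The three lower bounds on A give, in turn, ε ≤
  -- 1, |μ|² ≤ 4A, and δ d ≤ 1 for δ = K / √A.
  refine ⟨d * (d * (4 * (K + 2) * √Cg)) ^ 2 + 1, by positivity,
    max 1 (max (3 * Cη) ((K * d) ^ 2)), by positivity, fun A hA x y hxy _ => ?_⟩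
  simp only [gt_iff_lt, max_lt_iff] at hA
  obtain ⟨hA1, hA2, hA3⟩ := hA
  have hsq1 : 1 ≤ √A := Real.one_le_sqrt.2 hA1.le
  have hsqK : K * d ≤ √A := Real.le_sqrt_of_sq_le hA3.le
  have hder := hK_le A hA1.le (comps V μ x) (comps V η y)
    (dot_le_of_dot_add_le hxy.2 ((mul_le_mul_of_nonneg_left (hη_le y) (by norm_num)).trans hA2.le))
    (abs_le_of_dot_le (Real.sqrt_nonneg _) ((hη_le y).trans_eq (Real.sq_sqrt hCη.le).symm))
  have hKdiv : K / √A ≤ K := div_le_self hK.le hsq1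
  have hα := contDiff_rescale haf.smooth_a A
  have hφ := contDiff_rescale haf.smooth_f A
  have h := (SM.tangent x).cliffOp_geSmulId (SN.tangent y) (fun j => genField (V j) x)
    (w := fun j => genField (V j) y) (psiDerivM_symm hα hφ (comps V μ x) (comps V η y))
    (fun j k => (hder j k).1)
    (by rw [div_mul_eq_mul_div]; exact div_le_one_of_le₀ hsqK (by positivity))
    -- Entries of P are within K / √A ≤ K of 2 or 0, so K + 2 bounds the entries of both P and Q.
    (K := K + 2)
    (fun j k => by
      have h1 := abs_add_le (psiDerivM (rescale a A) (rescale f A) (comps V μ x) (comps V η y) j k -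
        if j = k then 2 else 0) (if j = k then 2 else 0)
      rw [sub_add_cancel] at h1
      have h2 : |(if j = k then 2 else 0 : ℝ)| ≤ 2 := by split_ifs <;> norm_num
      linarith [(hder j k).1])
    (fun j k => (hder j k).2.trans (by linarith)) (Real.sqrt_nonneg Cg)
    (fun j => (hg_le y j).trans_eq (Real.sq_sqrt hCg.le).symm)
  rw [opI12_eq_cliffOp V hμ hη hα hφ]
  refine ⟨h.1, fun σ => le_trans ?_ (h.2 σ)⟩
  have hnn : 0 ≤ ((prodStr SM SN x y).spinorInner σ σ).re :=
    (prodStr SM SN x y).spinorCore.re_inner_nonneg σ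
  exact mul_le_mul_of_nonneg_right (by linarith) hnn
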